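/- Let $\mathbb K$ be $\mathbb R$ or $\mathbb C$; all locally convex spaces are Hausdorff and over $\mathbb K$. A bilinear map $h\colon E\times F\to G$ of locally convex spaces is called hypocontinuous with respect to families $\mathfrak S$ and $\mathfrak T$ of subsets of $E$ and $F$ if it is separately continuous and for all $S\in\mathfrak S$, $T\in\mathfrak T$ and every $0$-neighbourhood $W$ in $G$ there are $0$-neighbourhoods $V$ in $F$ and $U$ in $E$ with $h(S\times V)\subseteq W$ and $h(U\times T)\subseteq W$; it is called hypocontinuous if this holds for the families of all bounded subsets of $E$ and of $F$. For a locally convex space $H$ let $H'_c$ be its dual space with the topology of uniform convergence on absolutely convex compact subsets of $H$. For locally convex spaces $H,K$ let $H\,\varepsilon\,K$ be the vector space of all bilinear forms $H'_c\times K'_c\to\mathbb K$ that are hypocontinuous with respect to the equicontinuous subsets of $H'$ and of $K'$, with the topology of uniform convergence on products of equicontinuous subsets of $H'$ and $K'$. For continuous linear maps $p\colon H_1\to H_2$ and $q\colon K_1\to K_2$ let $p\,\varepsilon\,q\colon H_1\,\varepsilon\,K_1\to H_2\,\varepsilon\,K_2$ be the canonical map $(p\,\varepsilon\,q)(u)(\varphi,\psi)=u(\varphi\circ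 p,\psi\circ q)$. Let $A\widehat\otimes B$ denote the completion of $A\otimes B$ for the projective topology. Let $A$ and $B$ be nuclear Fréchet spaces and let $M_1,M_2,N_1,N_2$ be locally convex spaces with $M_2$ and $N_2$ complete. Let $f\colon A\times M_1\to M_2$ and $g\colon B\times N_1\to N_2$ be hypocontinuous bilinear maps. Then there exists a unique separately continuous bilinear map $$\sigma\colon (A\widehat\otimes B)\times (M_1\,\varepsilon\,N_1)\to M_2\,\varepsilon\,N_2$$ satisfying $$\sigma(a\otimes b,u)=\bigl(f(a,\cdot)\,\varepsilon\,g(b,\cdot)\bigr)(u)\qquad\text{for all } a\in A,\ b\in B,\ u\in M_1\,\varepsilon\,N_1.$$ Moreover, $\sigma$ is hypocontinuous. -/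

import Mathlib

open scoped Topology TensorProduct

noncomputable section

namespace LCS

/-! ### Bilinear maps -/

section Bilinear

variable {𝕜 : Type*} [RCLike 𝕜]
  {E : Type*} [AddCommGroup E] [Module 𝕜 E] [TopologicalSpace E]
  {F : Type*} [AddCommGroup F] [Module 𝕜 F] [TopologicalSpace F]
  {G : Type*} [AddCommGroup G] [Module 𝕜 G] [TopologicalSpace G]

/-- A bilinear map is separately continuous if all its partial maps are continuous. -/
structure IsSeparatelyContinuous (f : E →ₗ[𝕜] F →ₗ[𝕜] G) : Prop where
  continuous_right : ∀ x, Continuous fun y => f x y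
  continuous_left : ∀ y, Continuous fun x => f x y

/-- A bilinear map `E × F → G` is hypocontinuous with respect to a family `𝔖` of subsets of `E`
and a family `𝔗` of subsets of `F` if it is separately continuous and for every `0`-neighbourhood
`W` in `G`, every `S ∈ 𝔖` and every `T ∈ 𝔗` there are `0`-neighbourhoods `V` in `F` and `U` in `E`
such that `f (S × V) ⊆ W` and `f (U × T) ⊆ W`. -/
structure IsHypocontinuousOn (𝔖 : Set (Set E)) (𝔗 : Set (Set F)) (f : E →ₗ[𝕜] F →ₗ[𝕜] G) :
    Prop extends IsSeparatelyContinuous f where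
  hypo_left : ∀ S ∈ 𝔖, ∀ W ∈ 𝓝 (0 : G), ∃ V ∈ 𝓝 (0 : F), ∀ x ∈ S, ∀ y ∈ V, f x y ∈ W
  hypo_right : ∀ T ∈ 𝔗, ∀ W ∈ 𝓝 (0 : G), ∃ U ∈ 𝓝 (0 : E), ∀ x ∈ U, ∀ y ∈ T, f x y ∈ W

/-- Hypocontinuity with respect to the bounded subsets of both factors. -/
def IsHypocontinuous (f : E →ₗ[𝕜] F →ₗ[𝕜] G) : Prop :=
  IsHypocontinuousOn {S | Bornology.IsVonNBounded 𝕜 S} {T | Bornology.IsVonNBounded 𝕜 T} f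

/-- The continuous linear map `f(x, ·)` of a separately continuous bilinear map `f`. -/
def IsSeparatelyContinuous.partialMap {f : E →ₗ[𝕜] F →ₗ[𝕜] G} (hf : IsSeparatelyContinuous f)
    (x : E) : F →L[𝕜] G :=
  ⟨f x, hf.continuous_right x⟩

end Bilinear

section HypoMaps

variable (𝕜 : Type*) [RCLike 𝕜]
  {E : Type*} [AddCommGroup E] [Module 𝕜 E] [TopologicalSpace E]
  {F : Type*} [AddCommGroup F] [Module 𝕜 F] [TopologicalSpace F]
  (G : Type*) [AddCommGroup G] [Module 𝕜 G] [TopologicalSpace G] [IsTopologicalAddGroup G]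
  [ContinuousSMul 𝕜 G]
  (𝔖 : Set (Set E)) (𝔗 : Set (Set F))

/-- The vector space of the bilinear maps `E × F → G` that are hypocontinuous with respect to `𝔖`
and `𝔗`. -/
def hypocontinuousSubmodule : Submodule 𝕜 (E →ₗ[𝕜] F →ₗ[𝕜] G) where
  carrier := {u | IsHypocontinuousOn 𝔖 𝔗 u}
  zero_mem' := by
    refine ⟨⟨fun _ => continuous_const, fun _ => continuous_const⟩, ?_, ?_⟩
    · intro S _ W hW
      exact ⟨Set.univ, Filter.univ_mem, fun _ _ _ _ => mem_of_mem_nhds hW⟩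
    · intro S _ W hW
      exact ⟨Set.univ, Filter.univ_mem, fun _ _ _ _ => mem_of_mem_nhds hW⟩
  add_mem' := by
    intro u v hu hv
    refine ⟨⟨fun x => (hu.continuous_right x).add (hv.continuous_right x),
      fun y => (hu.continuous_left y).add (hv.continuous_left y)⟩, ?_, ?_⟩
    · intro S hS W hW
      obtain ⟨W', hW', h⟩ := exists_nhds_zero_half hW
      obtain ⟨V₁, hV₁, h₁⟩ := hu.hypo_left S hS W' hW'
      obtain ⟨V₂, hV₂, h₂⟩ := hv.hypo_left S hS W' hW'
      exact ⟨V₁ ∩ V₂, Filter.inter_mem hV₁ hV₂,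
        fun x hx y hy => h _ (h₁ x hx y hy.1) _ (h₂ x hx y hy.2)⟩
    · intro S hS W hW
      obtain ⟨W', hW', h⟩ := exists_nhds_zero_half hW
      obtain ⟨V₁, hV₁, h₁⟩ := hu.hypo_right S hS W' hW'
      obtain ⟨V₂, hV₂, h₂⟩ := hv.hypo_right S hS W' hW'
      exact ⟨V₁ ∩ V₂, Filter.inter_mem hV₁ hV₂,
        fun x hx y hy => h _ (h₁ x hx.1 y hy) _ (h₂ x hx.2 y hy)⟩
  smul_mem' := by
    intro c u hu
    have key : ∀ W ∈ 𝓝 (0 : G), (fun z : G => c • z) ⁻¹' W ∈ 𝓝 (0 : G) := fun W hW =>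
      (continuous_const_smul c).continuousAt.preimage_mem_nhds (by simpa using hW)
    refine ⟨⟨fun x => (hu.continuous_right x).const_smul c,
      fun y => (hu.continuous_left y).const_smul c⟩, ?_, ?_⟩
    · intro S hS W hW
      exact hu.hypo_left S hS _ (key W hW)
    · intro S hS W hW
      exact hu.hypo_right S hS _ (key W hW)

/-- The same space as a type. -/
def HypocontinuousMaps : Type _ := hypocontinuousSubmodule 𝕜 G 𝔖 𝔗

instance : AddCommGroup (HypocontinuousMaps 𝕜 G 𝔖 𝔗) :=
  inferInstanceAs (AddCommGroup (hypocontinuousSubmodule 𝕜 G 𝔖 𝔗))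

instance : Module 𝕜 (HypocontinuousMaps 𝕜 G 𝔖 𝔗) :=
  inferInstanceAs (Module 𝕜 (hypocontinuousSubmodule 𝕜 G 𝔖 𝔗))

end HypoMaps

/-! ### The ε-product -/

section EpsProduct

variable (𝕜 : Type*) [RCLike 𝕜]
  (H : Type*) [AddCommGroup H] [Module 𝕜 H] [Module ℝ H] [TopologicalSpace H]
  (K : Type*) [AddCommGroup K] [Module 𝕜 K] [Module ℝ K] [TopologicalSpace K]

/-- The absolutely convex compact subsets of `H`. -/
def absConvexCompacts : Set (Set H) := {C | Balanced 𝕜 C ∧ Convex ℝ C ∧ IsCompact C}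

/-- `H'_c`: the continuous dual of `H` with the topology of uniform convergence on the absolutely
convex compact subsets of `H`. -/
def DualC : Type _ :=
  UniformConvergenceCLM (RingHom.id 𝕜) (E := H) 𝕜 (absConvexCompacts 𝕜 H)

instance : AddCommGroup (DualC 𝕜 H) :=
  inferInstanceAs (AddCommGroup (UniformConvergenceCLM (RingHom.id 𝕜) 𝕜 (absConvexCompacts 𝕜 H)))

instance : Module 𝕜 (DualC 𝕜 H) :=
  inferInstanceAs (Module 𝕜 (UniformConvergenceCLM (RingHom.id 𝕜) 𝕜 (absConvexCompacts 𝕜 H)))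

instance : TopologicalSpace (DualC 𝕜 H) :=
  inferInstanceAs
    (TopologicalSpace (UniformConvergenceCLM (RingHom.id 𝕜) 𝕜 (absConvexCompacts 𝕜 H)))

instance : FunLike (DualC 𝕜 H) H 𝕜 :=
  inferInstanceAs (FunLike (UniformConvergenceCLM (RingHom.id 𝕜) 𝕜 (absConvexCompacts 𝕜 H)) H 𝕜)

/-- The equicontinuous subsets of the dual of `H`. -/
def equicontinuousSets : Set (Set (DualC 𝕜 H)) :=
  {X | Equicontinuous fun (φ : X) (x : H) => φ.1 x}

/-- The ε-product `H ε K`: the space of the bilinear forms on `H'_c × K'_c` that are hypocontinuous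
with respect to the equicontinuous subsets of `H'` and of `K'`. -/
def EpsProduct : Type _ :=
  HypocontinuousMaps 𝕜 𝕜 (equicontinuousSets 𝕜 H) (equicontinuousSets 𝕜 K)

instance : AddCommGroup (EpsProduct 𝕜 H K) :=
  inferInstanceAs
    (AddCommGroup (HypocontinuousMaps 𝕜 𝕜 (equicontinuousSets 𝕜 H) (equicontinuousSets 𝕜 K)))

instance : Module 𝕜 (EpsProduct 𝕜 H K) :=
  inferInstanceAs
    (Module 𝕜 (HypocontinuousMaps 𝕜 𝕜 (equicontinuousSets 𝕜 H) (equicontinuousSets 𝕜 K)))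

variable {𝕜 H K} in
/-- The bilinear form underlying an element of `H ε K`. -/
def EpsProduct.form (u : EpsProduct 𝕜 H K) : DualC 𝕜 H →ₗ[𝕜] DualC 𝕜 K →ₗ[𝕜] 𝕜 := u.1

/-- The topology of `H ε K`: uniform convergence on the products `X × Y` of equicontinuous sets
`X ⊆ H'` and `Y ⊆ K'`. -/
instance : TopologicalSpace (EpsProduct 𝕜 H K) :=
  TopologicalSpace.induced
    (fun u => UniformOnFun.ofFun
      (Set.image2 (fun X Y => X ×ˢ Y) (equicontinuousSets 𝕜 H) (equicontinuousSets 𝕜 K))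
      fun p : DualC 𝕜 H × DualC 𝕜 K => u.form p.1 p.2)
    inferInstance

end EpsProduct

section EpsMap

variable {𝕜 : Type*} [RCLike 𝕜]
  {H₁ : Type*} [AddCommGroup H₁] [Module 𝕜 H₁] [Module ℝ H₁] [IsScalarTower ℝ 𝕜 H₁]
  [TopologicalSpace H₁]
  {H₂ : Type*} [AddCommGroup H₂] [Module 𝕜 H₂] [Module ℝ H₂] [IsScalarTower ℝ 𝕜 H₂]
  [TopologicalSpace H₂]
  {K₁ : Type*} [AddCommGroup K₁] [Module 𝕜 K₁] [Module ℝ K₁] [IsScalarTower ℝ 𝕜 K₁]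
  [TopologicalSpace K₁]
  {K₂ : Type*} [AddCommGroup K₂] [Module 𝕜 K₂] [Module ℝ K₂] [IsScalarTower ℝ 𝕜 K₂]
  [TopologicalSpace K₂]

theorem image_mem_absConvexCompacts (f : H₁ →L[𝕜] H₂) {C : Set H₁}
    (hC : C ∈ absConvexCompacts 𝕜 H₁) : f '' C ∈ absConvexCompacts 𝕜 H₂ := by
  refine ⟨?_, ?_, hC.2.2.image f.continuous⟩
  · rintro a ha _ ⟨_, ⟨x, hx, rfl⟩, rfl⟩
    exact ⟨a • x, hC.1 a ha ⟨x, hx, rfl⟩, map_smul f a x⟩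
  · exact hC.2.1.linear_image (f.toLinearMap.restrictScalars ℝ)

/-- The transpose `H₂'_c → H₁'_c`, `φ ↦ φ ∘ f`, of a continuous linear map `f : H₁ → H₂`. -/
def transpose (f : H₁ →L[𝕜] H₂) : DualC 𝕜 H₂ →L[𝕜] DualC 𝕜 H₁ :=
  f.precompUniformConvergenceCLM 𝕜 (absConvexCompacts 𝕜 H₁) (absConvexCompacts 𝕜 H₂)
    fun _ hC => image_mem_absConvexCompacts f hC

theorem transpose_apply (f : H₁ →L[𝕜] H₂) (φ : DualC 𝕜 H₂) (x : H₁) :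
    transpose f φ x = φ (f x) := rfl

theorem transpose_image_mem (f : H₁ →L[𝕜] H₂) {X : Set (DualC 𝕜 H₂)}
    (hX : X ∈ equicontinuousSets 𝕜 H₂) : transpose f '' X ∈ equicontinuousSets 𝕜 H₁ := by
  intro x U hU
  have h := f.continuous.continuousAt.eventually (hX (f x) U hU)
  filter_upwards [h] with y hy
  rintro ⟨_, φ, hφ, rfl⟩
  exact hy ⟨φ, hφ⟩

/-- The canonical map `f ε g : H₁ ε K₁ → H₂ ε K₂`, given by
`(f ε g)(u)(φ, ψ) = u(φ ∘ f, ψ ∘ g)`. -/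
def epsMap (f : H₁ →L[𝕜] H₂) (g : K₁ →L[𝕜] K₂) :
    EpsProduct 𝕜 H₁ K₁ →ₗ[𝕜] EpsProduct 𝕜 H₂ K₂ where
  toFun u := ⟨u.form.compl₁₂ (transpose f).toLinearMap (transpose g).toLinearMap, by
    have hu := u.2
    refine ⟨⟨fun φ => (hu.continuous_right _).comp (transpose g).continuous,
      fun ψ => (hu.continuous_left _).comp (transpose f).continuous⟩, ?_, ?_⟩
    · intro S hS W hW
      obtain ⟨V, hV, h⟩ := hu.hypo_left _ (transpose_image_mem f hS) W hW
      exact ⟨transpose g ⁻¹' V,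
        (transpose g).continuous.continuousAt.preimage_mem_nhds (by simpa using hV),
        fun φ hφ ψ hψ => h _ ⟨φ, hφ, rfl⟩ _ hψ⟩
    · intro S hS W hW
      obtain ⟨V, hV, h⟩ := hu.hypo_right _ (transpose_image_mem g hS) W hW
      exact ⟨transpose f ⁻¹' V,
        (transpose f).continuous.continuousAt.preimage_mem_nhds (by simpa using hV),
        fun φ hφ ψ hψ => h _ hφ _ ⟨ψ, hψ, rfl⟩⟩⟩
  map_add' _ _ := rfl
  map_smul' _ _ := rfl

theorem epsMap_form (f : H₁ →L[𝕜] H₂) (g : K₁ →L[𝕜] K₂) (u : EpsProduct 𝕜 H₁ K₁)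
    (φ : DualC 𝕜 H₂) (ψ : DualC 𝕜 K₂) :
    (epsMap f g u).form φ ψ = u.form (transpose f φ) (transpose g ψ) := rfl

end EpsMap

/-! ### Nuclear spaces -/

section Nuclear

variable {𝕜 : Type*} [RCLike 𝕜] {E : Type*} [AddCommGroup E] [Module 𝕜 E]

/-- The space `E` equipped with a single seminorm `p`. -/
def WithSeminorm (_ : Seminorm 𝕜 E) : Type _ := E

instance (p : Seminorm 𝕜 E) : SeminormedAddCommGroup (WithSeminorm p) :=
  AddGroupSeminorm.toSeminormedAddCommGroup (E := E) p.toAddGroupSeminorm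

instance (p : Seminorm 𝕜 E) : Module 𝕜 (WithSeminorm p) := inferInstanceAs (Module 𝕜 E)

instance (p : Seminorm 𝕜 E) : NormedSpace 𝕜 (WithSeminorm p) where
  norm_smul_le a x := (map_smul_eq_mul p a x).le

/-- The local Banach space of `p`: the Hausdorff completion of `(E, p)`, that is, the completion
of `E / ker p` for the norm induced by `p`. -/
abbrev LocalBanach (p : Seminorm 𝕜 E) : Type _ := UniformSpace.Completion (WithSeminorm p)

/-- The canonical map of `E` into the local Banach space of `p`. -/
def toLocalBanach (p : Seminorm 𝕜 E) (x : E) : LocalBanach p :=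
  ((show WithSeminorm p from x : WithSeminorm p) : UniformSpace.Completion (WithSeminorm p))

/-- A map `T` from a locally convex space `E` to a Banach space `F` is nuclear if it has the form
`T x = ∑ cₙ φₙ(x) yₙ` with `(cₙ)` absolutely summable, `(φₙ)` an equicontinuous sequence in the
dual of `E`, and `(yₙ)` a bounded sequence in `F`. -/
def IsNuclearMap (𝕜 : Type*) [RCLike 𝕜] {E : Type*} [AddCommGroup E] [Module 𝕜 E]
    [TopologicalSpace E] {F : Type*} [NormedAddCommGroup F] [NormedSpace 𝕜 F] (T : E → F) :
    Prop :=
  ∃ (c : ℕ → 𝕜) (φ : ℕ → E →L[𝕜] 𝕜) (y : ℕ → F),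
    (Summable fun n => ‖c n‖) ∧ (Equicontinuous fun n (x : E) => φ n x) ∧
    (∃ C : ℝ, ∀ n, ‖y n‖ ≤ C) ∧ ∀ x, HasSum (fun n => (c n * φ n x) • y n) (T x)

/-- A locally convex space is nuclear if for each continuous seminorm `p` the canonical map into
the local Banach space of `p` is nuclear. -/
def IsNuclearSpace (𝕜 : Type*) [RCLike 𝕜] (E : Type*) [AddCommGroup E] [Module 𝕜 E]
    [TopologicalSpace E] : Prop :=
  ∀ p : Seminorm 𝕜 E, Continuous p → IsNuclearMap 𝕜 (toLocalBanach p)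

end Nuclear

/-! ### The completed projective tensor product -/

section Projective

variable (𝕜 : Type*) [RCLike 𝕜]
  (A : Type*) [AddCommGroup A] [Module 𝕜 A] [TopologicalSpace A]
  (B : Type*) [AddCommGroup B] [Module 𝕜 B] [TopologicalSpace B]

/-- The algebraic tensor product, to be equipped with the projective topology. -/
def ProjTensor : Type _ := A ⊗[𝕜] B

instance : AddCommGroup (ProjTensor 𝕜 A B) := inferInstanceAs (AddCommGroup (A ⊗[𝕜] B))

instance : Module 𝕜 (ProjTensor 𝕜 A B) := inferInstanceAs (Module 𝕜 (A ⊗[𝕜] B))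

variable {A B} in
/-- The elementary tensor `a ⊗ b` in `A ⊗ B`. -/
def ProjTensor.tmul (a : A) (b : B) : ProjTensor 𝕜 A B := (a ⊗ₜ[𝕜] b : A ⊗[𝕜] B)

/-- The seminorms `r` on `A ⊗ B` for which `(a, b) ↦ r (a ⊗ b)` is continuous on `A × B`. -/
def ProjTensor.Index : Type _ :=
  {r : Seminorm 𝕜 (ProjTensor 𝕜 A B) // Continuous fun z : A × B => r (.tmul 𝕜 z.1 z.2)}

instance : Nonempty (ProjTensor.Index 𝕜 A B) := ⟨⟨0, continuous_const⟩⟩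

/-- The family of all those seminorms. -/
def ProjTensor.seminorms : SeminormFamily 𝕜 (ProjTensor 𝕜 A B) (ProjTensor.Index 𝕜 A B) :=
  fun r => r.1

/-- The projective topology: the finest locally convex topology on `A ⊗ B` for which the canonical
map `A × B → A ⊗ B` is (jointly) continuous. Its continuous seminorms are exactly the seminorms `r`
such that `(a, b) ↦ r (a ⊗ b)` is continuous, and it is generated by them. -/
abbrev ProjTensor.topology : TopologicalSpace (ProjTensor 𝕜 A B) :=
  (ProjTensor.seminorms 𝕜 A B).moduleFilterBasis.topology

/-- The additive uniformity of the projective topology. -/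
instance : UniformSpace (ProjTensor 𝕜 A B) :=
  letI := ProjTensor.topology 𝕜 A B
  haveI : IsTopologicalAddGroup (ProjTensor 𝕜 A B) :=
    (ProjTensor.seminorms 𝕜 A B).addGroupFilterBasis.isTopologicalAddGroup
  IsTopologicalAddGroup.rightUniformSpace (ProjTensor 𝕜 A B)

theorem ProjTensor.withSeminorms : WithSeminorms (ProjTensor.seminorms 𝕜 A B) := ⟨rfl⟩

instance : IsTopologicalAddGroup (ProjTensor 𝕜 A B) :=
  (ProjTensor.withSeminorms 𝕜 A B).topologicalAddGroup

instance : IsUniformAddGroup (ProjTensor 𝕜 A B) :=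
  letI := ProjTensor.topology 𝕜 A B
  isUniformAddGroup_of_addCommGroup

instance : ContinuousSMul 𝕜 (ProjTensor 𝕜 A B) :=
  (ProjTensor.withSeminorms 𝕜 A B).continuousSMul

instance : UniformContinuousConstSMul 𝕜 (ProjTensor 𝕜 A B) :=
  uniformContinuousConstSMul_of_continuousConstSMul 𝕜 _

/-- The completed projective tensor product of `A` and `B`. -/
abbrev CompletedTensor : Type _ := UniformSpace.Completion (ProjTensor 𝕜 A B)

variable {A B} in
/-- The elementary tensor `a ⊗ b` in the completed projective tensor product. -/
def CompletedTensor.tmul (a : A) (b : B) : CompletedTensor 𝕜 A B :=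
  (ProjTensor.tmul 𝕜 a b : UniformSpace.Completion (ProjTensor 𝕜 A B))

end Projective

end LCS

end

/-! For fixed `u`, `φ`, `ψ` the formula for `σ` prescribes the bilinear form `(a, b) ↦ u(φ ∘ f(a,
·), ψ ∘ g(b, ·))` on `A × B`. Hypocontinuity of `f` and `g` bounds it on products of bounded sets.
As `A` and `B` are metrizable, such a form is jointly continuous (`exists_nhds_norm_le_of_bounded`),
so it extends to a continuous linear form on the completed tensor product; its value at `z` is `σ(z,
u)(φ, ψ)`.

The other ingredient is Grothendieck's description of totally bounded sets: each lies in the closed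
absolutely convex hull of `K ⊗ L` with `K`, `L` compact
(`CompletedTensor.exists_isCompact_subset_closure`). On such a set `σ(z, u)(φ, ψ)` is controlled by
the values `u(φ ∘ f(a, ·), ψ ∘ g(b, ·))` with `a ∈ K`, `b ∈ L`. The functionals `φ ∘ f(a, ·)`, for
`φ` in an equicontinuous set and `a ∈ K`, are equicontinuous. They tend to `0` in `M₁'_c` uniformly
in `a ∈ K` when `φ → 0` in `M₂'_c`, because `f(K × C)` is compact for compact `C` and lies in an
absolutely convex compact subset of the complete space `M₂`. The same holds for `g`. Applied to a
single `z`, this puts `σ(z, u)` into `M₂ ε N₂`.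

Nuclearity makes bounded subsets of the completed tensor product totally bounded
(`CompletedTensor.exists_finite_cover`), so the same control gives hypocontinuity over bounded sets
of tensors. Over bounded sets of `u` it follows from the equicontinuity of the bilinear forms.
Uniqueness is density of `A ⊗ B`. -/

noncomputable section

namespace LCS

/-! ### Absolutely convex hulls in the algebraic tensor product -/

section TensorHull

variable {𝕜 : Type*} [RCLike 𝕜]
  {A : Type*} [AddCommGroup A] [Module 𝕜 A]
  {B : Type*} [AddCommGroup B] [Module 𝕜 B]

theorem ProjTensor.tmul_add_left (a a' : A) (b : B) :
    tmul 𝕜 (a + a') b = tmul 𝕜 a b + tmul 𝕜 a' b := TensorProduct.add_tmul a a' b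

theorem ProjTensor.tmul_add_right (a : A) (b b' : B) :
    tmul 𝕜 a (b + b') = tmul 𝕜 a b + tmul 𝕜 a b' := TensorProduct.tmul_add a b b'

theorem ProjTensor.tmul_smul_left (c : 𝕜) (a : A) (b : B) :
    tmul 𝕜 (c • a) b = c • tmul 𝕜 a b := TensorProduct.smul_tmul' c a b

theorem ProjTensor.tmul_smul_right (c : 𝕜) (a : A) (b : B) :
    tmul 𝕜 a (c • b) = c • tmul 𝕜 a b := TensorProduct.tmul_smul c a b

/-- The canonical bilinear map `A × B → A ⊗ B`. -/
def ProjTensor.mk₂ : A →ₗ[𝕜] B →ₗ[𝕜] ProjTensor 𝕜 A B :=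
  LinearMap.mk₂ 𝕜 (tmul 𝕜) tmul_add_left tmul_smul_left tmul_add_right tmul_smul_right

theorem ProjTensor.induction {P : ProjTensor 𝕜 A B → Prop} (z : ProjTensor 𝕜 A B)
    (zero : P 0) (tmul : ∀ a b, P (tmul 𝕜 a b)) (add : ∀ x y, P x → P y → P (x + y)) : P z :=
  TensorProduct.induction_on z zero tmul add

/-- `TensorHull U V r z` says that `z` is a finite sum `∑ cᵢ aᵢ ⊗ bᵢ` with `aᵢ ∈ U`, `bᵢ ∈ V` and
`∑ |cᵢ| ≤ r`. -/
inductive TensorHull (U : Set A) (V : Set B) : ℝ → ProjTensor 𝕜 A B → Prop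
  | zero {r : ℝ} : 0 ≤ r → TensorHull U V r 0
  | cons {r : ℝ} {z : ProjTensor 𝕜 A B} (c : 𝕜) {a : A} {b : B} : a ∈ U → b ∈ V →
      TensorHull U V r z → TensorHull U V (‖c‖ + r) (c • .tmul 𝕜 a b + z)

namespace TensorHull

variable {U U' : Set A} {V V' : Set B} {r s : ℝ} {z w : ProjTensor 𝕜 A B}

theorem nonneg (h : TensorHull U V r z) : 0 ≤ r := by
  induction h with
  | zero h => exact h
  | cons c _ _ _ ih => positivity

theorem mono_right (h : TensorHull U V r z) (hrs : r ≤ s) : TensorHull U V s z := by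
  induction h generalizing s with
  | zero h => exact .zero (h.trans hrs)
  | cons c ha hb _ ih =>
    have := TensorHull.cons c ha hb (ih (s := s - ‖c‖) (by linarith))
    simpa using this

theorem mono (h : TensorHull U V r z) (hU : U ⊆ U') (hV : V ⊆ V') : TensorHull U' V' r z := by
  induction h with
  | zero h => exact .zero h
  | cons c ha hb _ ih => exact .cons c (hU ha) (hV hb) ih

theorem add (hz : TensorHull U V r z) (hw : TensorHull U V s w) :
    TensorHull U V (r + s) (z + w) := by
  induction hz with
  | zero h => simpa using hw.mono_right (by linarith)
  | cons c ha hb _ ih =>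
    rw [add_assoc, add_assoc]
    exact .cons c ha hb ih

theorem smul (c : 𝕜) (hz : TensorHull U V r z) : TensorHull U V (‖c‖ * r) (c • z) := by
  induction hz with
  | zero h => simpa using TensorHull.zero (mul_nonneg (norm_nonneg c) h)
  | cons d ha hb _ ih =>
    rw [smul_add, smul_smul, mul_add, ← norm_mul]
    exact .cons _ ha hb ih

theorem smul_tmul (c : 𝕜) {a : A} {b : B} (ha : a ∈ U) (hb : b ∈ V) :
    TensorHull U V ‖c‖ (c • ProjTensor.tmul 𝕜 a b) := by
  simpa using TensorHull.cons c ha hb (.zero le_rfl)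

theorem tmul {a : A} {b : B} (ha : a ∈ U) (hb : b ∈ V) :
    TensorHull U V 1 (ProjTensor.tmul 𝕜 a b) := by
  simpa using smul_tmul (1 : 𝕜) ha hb

/-- A seminorm bounded by `M` on the tensors `a ⊗ b` is bounded by `M r` on the hull. -/
theorem seminorm_le (p : Seminorm 𝕜 (ProjTensor 𝕜 A B)) {M : ℝ}
    (hM : 0 ≤ M) (hp : ∀ a ∈ U, ∀ b ∈ V, p (.tmul 𝕜 a b) ≤ M) (h : TensorHull U V r z) :
    p z ≤ M * r := by
  induction h with
  | zero h => simpa using mul_nonneg hM h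
  | cons c ha hb _ ih =>
    calc _ ≤ p (c • _) + p _ := map_add_le_add p _ _
      _ ≤ ‖c‖ * M + M * _ := by
        rw [map_smul_eq_mul]; gcongr; exact hp _ ha _ hb
      _ = _ := by ring

/-- A map of tensor products that sends the generators into a hull sends the hull into it. -/
theorem map {A' B' : Type*} [AddCommGroup A'] [Module 𝕜 A'] [AddCommGroup B'] [Module 𝕜 B']
    {U' : Set A'} {V' : Set B'} (R : ProjTensor 𝕜 A B →ₗ[𝕜] ProjTensor 𝕜 A' B') {M : ℝ}
    (hR : ∀ a ∈ U, ∀ b ∈ V, TensorHull U' V' M (R (.tmul 𝕜 a b))) (hM : 0 ≤ M)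
    (h : TensorHull U V r z) : TensorHull U' V' (M * r) (R z) := by
  induction h with
  | zero h => simpa using TensorHull.zero (mul_nonneg hM h)
  | cons c ha hb _ ih =>
    rw [map_add, map_smul, mul_add, mul_comm M]
    exact ((hR _ ha _ hb).smul c).add ih

/-- Only finitely many vectors occur in a sum. This lets finite sets of tensors be replaced by
finite sets in the factors, from which compact sets are later assembled. -/
theorem exists_finite (h : TensorHull U V r z) :
    ∃ G : Set A, ∃ H : Set B, G.Finite ∧ H.Finite ∧ G ⊆ U ∧ H ⊆ V ∧ TensorHull G H r z := by
  induction h with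
  | zero h => exact ⟨∅, ∅, Set.finite_empty, Set.finite_empty, by simp, by simp, .zero h⟩
  | @cons r z c a b ha hb _ ih =>
    obtain ⟨G, H, hG, hH, hGU, hHV, h⟩ := ih
    exact ⟨insert a G, insert b H, hG.insert a, hH.insert b, Set.insert_subset ha hGU,
      Set.insert_subset hb hHV, .cons c (Set.mem_insert a G) (Set.mem_insert b H)
        (h.mono (Set.subset_insert a G) (Set.subset_insert b H))⟩

theorem exists_finite_of_finite {F : Set (ProjTensor 𝕜 A B)} (hF : F.Finite)
    (h : ∀ z ∈ F, TensorHull U V r z) :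
    ∃ G : Set A, ∃ H : Set B, G.Finite ∧ H.Finite ∧ G ⊆ U ∧ H ⊆ V ∧
      ∀ z ∈ F, TensorHull G H r z := by
  choose! G H hG hH hGU hHV hz using fun z hz => (h z hz).exists_finite
  exact ⟨⋃ z ∈ F, G z, ⋃ z ∈ F, H z, hF.biUnion hG, hF.biUnion hH, Set.iUnion₂_subset hGU,
    Set.iUnion₂_subset hHV, fun z hzF => (hz z hzF).mono
      (Set.subset_biUnion_of_mem hzF) (Set.subset_biUnion_of_mem hzF)⟩

/-- With no restriction on the vectors, any coefficient can be absorbed into the first factor, so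
the weight can be made as small as desired. -/
theorem univ (z : ProjTensor 𝕜 A B) (hr : 0 < r) :
    TensorHull (Set.univ : Set A) (Set.univ : Set B) r z := by
  induction z using ProjTensor.induction generalizing r with
  | zero => exact .zero hr.le
  | tmul a b =>
    have h := smul_tmul (U := Set.univ) (V := Set.univ) (r : 𝕜) (a := (r : 𝕜)⁻¹ • a) (b := b)
      trivial trivial
    rw [ProjTensor.tmul_smul_left, smul_inv_smul₀ (by exact_mod_cast hr.ne')] at h
    simpa [abs_of_pos hr] using h
  | add x y hx hy => simpa using (hx (half_pos hr)).add (hy (half_pos hr))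

theorem exists_of_absorbent (hU : Absorbent 𝕜 U) (hV : Absorbent 𝕜 V) (z : ProjTensor 𝕜 A B) :
    ∃ r, TensorHull U V r z := by
  induction z using ProjTensor.induction with
  | zero => exact ⟨0, .zero le_rfl⟩
  | tmul a b =>
    obtain ⟨c, hc⟩ := (hU a).exists
    obtain ⟨d, hd⟩ := (hV b).exists
    obtain ⟨a', ha', rfl⟩ := hc rfl
    obtain ⟨b', hb', rfl⟩ := hd rfl
    refine ⟨‖d * c‖, ?_⟩
    simpa [ProjTensor.tmul_smul_left, ProjTensor.tmul_smul_right, smul_smul]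
      using smul_tmul (d * c) ha' hb'
  | add x y hx hy =>
    obtain ⟨r, hx⟩ := hx
    obtain ⟨s, hy⟩ := hy
    exact ⟨r + s, hx.add hy⟩

variable (𝕜) in
/-- The gauge of the hull of `U ⊗ V`. -/
def gauge (hU : Absorbent 𝕜 U) (hV : Absorbent 𝕜 V) : Seminorm 𝕜 (ProjTensor 𝕜 A B) :=
  have hbdd (z : ProjTensor 𝕜 A B) : BddBelow {r : ℝ | TensorHull U V r z} :=
    ⟨0, fun _ h => h.nonneg⟩
  Seminorm.ofSMulLE (fun z => sInf {r : ℝ | TensorHull U V r z})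
    (le_antisymm (csInf_le (hbdd 0) (.zero le_rfl))
      (le_csInf ⟨0, .zero le_rfl⟩ fun _ h => h.nonneg))
    (fun z w => by
      refine le_of_forall_pos_le_add fun ε hε => ?_
      obtain ⟨r, hr, hr'⟩ := exists_lt_of_csInf_lt (exists_of_absorbent hU hV z)
        (lt_add_of_pos_right (sInf {r : ℝ | TensorHull U V r z}) (half_pos hε))
      obtain ⟨s, hs, hs'⟩ := exists_lt_of_csInf_lt (exists_of_absorbent hU hV w)
        (lt_add_of_pos_right (sInf {r : ℝ | TensorHull U V r w}) (half_pos hε))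
      have := csInf_le (hbdd (z + w)) (TensorHull.add hr hs)
      linarith)
    (fun c z => by
      refine le_of_forall_pos_le_add fun ε hε => ?_
      obtain ⟨r, hr, hr'⟩ := exists_lt_of_csInf_lt (exists_of_absorbent hU hV z)
        (lt_add_of_pos_right (sInf {r : ℝ | TensorHull U V r z})
          (show 0 < ε / (‖c‖ + 1) by positivity))
      have h := csInf_le (hbdd (c • z)) (TensorHull.smul c hr)
      have h' : ‖c‖ * (ε / (‖c‖ + 1)) ≤ ε := by
        rw [mul_div_assoc', div_le_iff₀ (by positivity)]
        nlinarith [norm_nonneg c]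
      nlinarith [norm_nonneg c])

theorem gauge_le (hU : Absorbent 𝕜 U) (hV : Absorbent 𝕜 V) (h : TensorHull U V r z) :
    gauge 𝕜 hU hV z ≤ r :=
  csInf_le ⟨0, fun _ h => h.nonneg⟩ h

theorem of_gauge_lt (hU : Absorbent 𝕜 U) (hV : Absorbent 𝕜 V) (h : gauge 𝕜 hU hV z < r) :
    TensorHull U V r z := by
  obtain ⟨s, hs, hsr⟩ := exists_lt_of_csInf_lt (exists_of_absorbent hU hV z) h
  exact TensorHull.mono_right hs hsr.le

end TensorHull

end TensorHull

/-! ### Hulls of neighbourhoods and the projective topology -/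

section Topology

variable {𝕜 : Type*} [RCLike 𝕜]
  {A : Type*} [AddCommGroup A] [Module 𝕜 A] [TopologicalSpace A] [IsTopologicalAddGroup A]
  [ContinuousSMul 𝕜 A]
  {B : Type*} [AddCommGroup B] [Module 𝕜 B] [TopologicalSpace B] [IsTopologicalAddGroup B]
  [ContinuousSMul 𝕜 B]

theorem preimage_smul_mem_nhds_zero {𝕜 A : Type*} [RCLike 𝕜] [AddCommGroup A] [Module 𝕜 A]
    [TopologicalSpace A] [ContinuousConstSMul 𝕜 A] {U : Set A} (hU : U ∈ 𝓝 0) (c : 𝕜) :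
    {a | c • a ∈ U} ∈ 𝓝 (0 : A) :=
  (continuous_const_smul c).continuousAt.preimage_mem_nhds (by simpa using hU)

/-- A seminorm on `A ⊗ B` that is bounded on `U ⊗ V` for `0`-neighbourhoods `U` and `V` induces a
continuous function on `A × B`. -/
theorem ProjTensor.continuous_seminorm_tmul (p : Seminorm 𝕜 (ProjTensor 𝕜 A B))
    {U : Set A} (hU : U ∈ 𝓝 0) {V : Set B} (hV : V ∈ 𝓝 0) {M : ℝ}
    (h : ∀ a ∈ U, ∀ b ∈ V, p (.tmul 𝕜 a b) ≤ M) :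
    Continuous fun z : A × B => p (.tmul 𝕜 z.1 z.2) := by
  -- Seen as a biadditive map into `(A ⊗ B, p)`, the tensor map is jointly continuous once it is so
  -- at `(0, 0)` and its partial maps are continuous at `0`.
  let T : A →+ B →+ WithSeminorm p := AddMonoidHom.mk'
    (fun a => AddMonoidHom.mk' (fun b => (show WithSeminorm p from .tmul 𝕜 a b))
      (tmul_add_right a)) (fun a a' => AddMonoidHom.ext (tmul_add_left a a'))
  have hT (a : A) (b : B) : ‖T a b‖ = p (.tmul 𝕜 a b) := rfl
  have hM : 0 ≤ M := (apply_nonneg p _).trans (h 0 (mem_of_mem_nhds hU) 0 (mem_of_mem_nhds hV))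
  -- Shrinking a neighbourhood by `t` divides the bound by `t`. Taking `s + 1` instead of `s` in the
  -- witness keeps `t` positive when `s = 0`.
  have small {s : ℝ} (hs : 0 ≤ s) {ε : ℝ} (hε : 0 < ε) :
      ∃ t : ℝ, 0 < t ∧ ∀ x, t * x ≤ s → x < ε := by
    refine ⟨(s + 1) / ε, by positivity, fun x hx => lt_of_not_ge fun hxε => ?_⟩
    have : (s + 1) / ε * ε ≤ (s + 1) / ε * x := by gcongr
    rw [div_mul_cancel₀ _ hε.ne'] at this
    linarith
  have key : Continuous fun z : A × B => T z.1 z.2 := by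
    refine continuous_of_continuousAt_zero₂ T ?_ (fun a => ?_) (fun b => ?_)
    · simp only [ContinuousAt, map_zero, NormedAddGroup.tendsto_nhds_zero]
      intro ε hε
      obtain ⟨t, ht, ht'⟩ := small hM hε
      filter_upwards [prod_mem_nhds (preimage_smul_mem_nhds_zero hU (t : 𝕜)) hV] with z hz
      have := h _ hz.1 _ hz.2
      rw [tmul_smul_left, map_smul_eq_mul, RCLike.norm_ofReal, abs_of_pos ht] at this
      exact ht' _ this
    · obtain ⟨c, hc⟩ := (absorbent_nhds_zero (𝕜 := 𝕜) hU a).exists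
      obtain ⟨a, ha, rfl⟩ := hc rfl
      rw [ContinuousAt, map_zero, NormedAddGroup.tendsto_nhds_zero]
      intro ε hε
      obtain ⟨t, ht, ht'⟩ := small (mul_nonneg (norm_nonneg c) hM) hε
      filter_upwards [preimage_smul_mem_nhds_zero hV (t : 𝕜)] with b hb
      have := h _ ha _ hb
      rw [tmul_smul_right, map_smul_eq_mul, RCLike.norm_ofReal, abs_of_pos ht] at this
      refine ht' _ ?_
      rw [hT]
      simp only [tmul_smul_left, map_smul_eq_mul]
      nlinarith [norm_nonneg c]
    · obtain ⟨c, hc⟩ := (absorbent_nhds_zero (𝕜 := 𝕜) hV b).exists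
      obtain ⟨b, hb, rfl⟩ := hc rfl
      rw [ContinuousAt, map_zero, AddMonoidHom.zero_apply, NormedAddGroup.tendsto_nhds_zero]
      intro ε hε
      obtain ⟨t, ht, ht'⟩ := small (mul_nonneg (norm_nonneg c) hM) hε
      filter_upwards [preimage_smul_mem_nhds_zero hU (t : 𝕜)] with a ha
      have := h _ ha _ hb
      rw [tmul_smul_left, map_smul_eq_mul, RCLike.norm_ofReal, abs_of_pos ht] at this
      refine ht' _ ?_
      rw [hT]
      simp only [tmul_smul_right, map_smul_eq_mul]
      nlinarith [norm_nonneg c]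
  exact key.norm

/-- The gauge of the hull is at most `1` on `U ⊗ V`, so it is one of the seminorms defining the
projective topology, and its open ball of radius `r` lies in the hull of weight `r`. -/
theorem ProjTensor.tensorHull_mem_nhds {U : Set A} (hU : U ∈ 𝓝 0) {V : Set B} (hV : V ∈ 𝓝 0)
    {r : ℝ} (hr : 0 < r) : {z | TensorHull U V r z} ∈ 𝓝 (0 : ProjTensor 𝕜 A B) := by
  have hU' : Absorbent 𝕜 U := absorbent_nhds_zero hU
  have hV' : Absorbent 𝕜 V := absorbent_nhds_zero hV
  let p : ProjTensor.Index 𝕜 A B := ⟨TensorHull.gauge 𝕜 hU' hV',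
    continuous_seminorm_tmul _ hU hV fun a ha b hb => TensorHull.gauge_le hU' hV' (.tmul ha hb)⟩
  have hp : Continuous (ProjTensor.seminorms 𝕜 A B p) :=
    (ProjTensor.withSeminorms 𝕜 A B).continuous_seminorm p
  have : ∀ᶠ z in 𝓝 0, ProjTensor.seminorms 𝕜 A B p z < r :=
    hp.continuousAt.eventually_lt_const (by simpa using hr)
  filter_upwards [this] with z hz
  exact TensorHull.of_gauge_lt hU' hV' hz

-- A basic neighbourhood involves finitely many defining seminorms. All are below `ε / 2` on a
-- suitable `U ⊗ V`, hence at most `ε / 2` on its hull.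
omit [IsTopologicalAddGroup A] [ContinuousSMul 𝕜 A] [IsTopologicalAddGroup B]
  [ContinuousSMul 𝕜 B] in
theorem ProjTensor.exists_tensorHull_subset {W : Set (ProjTensor 𝕜 A B)} (hW : W ∈ 𝓝 0) :
    ∃ U ∈ 𝓝 (0 : A), ∃ V ∈ 𝓝 (0 : B), ∀ z, TensorHull U V 1 z → z ∈ W := by
  obtain ⟨⟨s, ε⟩, hε, h⟩ := (ProjTensor.withSeminorms 𝕜 A B).hasBasis_zero_ball.mem_iff.1 hW
  simp only at hε
  have hev : ∀ᶠ z : A × B in 𝓝 (0, 0), ∀ p ∈ s, p.1 (.tmul 𝕜 z.1 z.2) < ε / 2 :=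
    (Filter.eventually_all_finset s).2 fun p _ =>
      p.2.continuousAt.eventually_lt_const (by
        change p.1 (tmul 𝕜 (0 : A) (0 : B)) < ε / 2
        rw [show tmul 𝕜 (0 : A) (0 : B) = 0 from TensorProduct.tmul_zero (R := 𝕜) B (0 : A),
          map_zero]
        exact half_pos hε)
  obtain ⟨U, hU, V, hV, hUV⟩ := mem_nhds_prod_iff.1 hev
  refine ⟨U, hU, V, hV, fun z hz => h ?_⟩
  rw [Seminorm.mem_ball_zero]
  refine Seminorm.finset_sup_apply_lt hε fun p hp => ?_
  have := hz.seminorm_le p.1 (half_pos hε).le fun a ha b hb => (hUV (Set.mk_mem_prod ha hb) p hp).le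
  exact this.trans_lt (by linarith)

end Topology

/-! ### Seminorms and finite-rank approximation on nuclear spaces -/

section LocallyConvex

variable {𝕜 : Type*} [RCLike 𝕜]
  {E : Type*} [AddCommGroup E] [Module 𝕜 E] [Module ℝ E] [IsScalarTower ℝ 𝕜 E]

theorem balanced_convexHull {s : Set E} (hs : Balanced 𝕜 s) : Balanced 𝕜 (convexHull ℝ s) := by
  rintro c hc _ ⟨x, hx, rfl⟩
  have h := LinearMap.image_convexHull ((LinearMap.lsmul 𝕜 E c).restrictScalars ℝ) s
  have h' : c • x ∈ convexHull ℝ ((LinearMap.lsmul 𝕜 E c).restrictScalars ℝ '' s) :=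
    h ▸ Set.mem_image_of_mem _ hx
  refine convexHull_mono ?_ h'
  rintro _ ⟨y, hy, rfl⟩
  exact hs.smul_mem hc hy

/-- The seminorm is the gauge of an absolutely convex neighbourhood inside `U`. Passing to the
interior makes the open unit ball of the gauge equal to the set itself. -/
theorem exists_continuous_seminorm [TopologicalSpace E] [IsTopologicalAddGroup E]
    [ContinuousSMul 𝕜 E] [LocallyConvexSpace ℝ E] {U : Set E} (hU : U ∈ 𝓝 0) :
    ∃ p : Seminorm 𝕜 E, Continuous p ∧ ∀ x, p x < 1 → x ∈ U := by
  have : ContinuousSMul ℝ E := IsScalarTower.continuousSMul 𝕜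
  obtain ⟨C, ⟨hC, hCconv⟩, hCU⟩ := (LocallyConvexSpace.convex_basis_zero ℝ E).mem_iff.1 hU
  let D := convexHull ℝ (balancedCore 𝕜 C)
  have hD : D ∈ 𝓝 (0 : E) :=
    Filter.mem_of_superset (balancedCore_mem_nhds_zero hC) (subset_convexHull ℝ _)
  have hDC : D ⊆ C := convexHull_min (balancedCore_subset C) hCconv
  have hD0 : (0 : E) ∈ interior D := mem_interior_iff_mem_nhds.2 hD
  have hbal : Balanced 𝕜 (interior D) :=
    (balanced_convexHull (balancedCore_balanced C)).interior hD0
  have hopen : IsOpen (interior D) := isOpen_interior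
  have hconv : Convex ℝ (interior D) := (convex_convexHull ℝ _).interior
  let p : Seminorm 𝕜 E :=
    gaugeSeminorm hbal hconv (absorbent_nhds_zero (hopen.mem_nhds hD0))
  have hp : p.ball 0 1 = interior D := gaugeSeminorm_ball_one hopen
  refine ⟨p, Seminorm.continuous (r := 1) (hp ▸ hopen.mem_nhds hD0), fun x hx => ?_⟩
  exact hCU (hDC (interior_subset (hp ▸ p.mem_ball_zero.2 hx)))

/-- On a nuclear space, the identity is approximated by maps of finite rank, uniformly on a
`0`-neighbourhood that depends only on the seminorm used to measure the approximation. -/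
theorem IsNuclearSpace.exists_finiteRank [TopologicalSpace E] [IsTopologicalAddGroup E]
    [ContinuousSMul 𝕜 E] [LocallyConvexSpace ℝ E] (hE : IsNuclearSpace 𝕜 E) {U : Set E}
    (hU : U ∈ 𝓝 0) :
    ∃ U' ∈ 𝓝 (0 : E), ∀ t : ℝ, 0 < t → ∃ (n : ℕ) (φ : Fin n → E →L[𝕜] 𝕜) (e : Fin n → E),
      ∀ x ∈ U', (∀ i, ‖φ i x‖ ≤ 1) ∧ (t : 𝕜) • (x - ∑ i, φ i x • e i) ∈ U := by
  obtain ⟨p, hp, hpU⟩ := exists_continuous_seminorm (𝕜 := 𝕜) hU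
  obtain ⟨c, φ, y, hc, hφ, ⟨C, hC⟩, hsum⟩ := hE p hp
  -- Equicontinuity makes `{x | ∀ n, |φ n x| < 1}` a `0`-neighbourhood. This is `U'`; it is chosen
  -- before `t`.
  have hφ0 := hφ 0 _ (Metric.dist_mem_uniformity one_pos)
  have hC0 : 0 ≤ C := (norm_nonneg _).trans (hC 0)
  refine ⟨_, hφ0, fun t ht => ?_⟩
  obtain ⟨n, hn⟩ := ((tendsto_sum_nat_add fun i => ‖c i‖ * C).eventually_lt_const
    (show 0 < 1 / (2 * t) by positivity)).exists
  -- The vectors `y i` lie only in the completion, so they are replaced by nearby `w i` from `E`.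
  -- With this tolerance the replacement costs at most `1 / (2t)` in total, as much as the discarded
  -- tail.
  have hη : 0 < 1 / (2 * t * (∑' i, ‖c i‖ + 1)) := by
    have : 0 ≤ ∑' i, ‖c i‖ := tsum_nonneg fun i => norm_nonneg _
    positivity
  choose w hw using fun i => UniformSpace.Completion.denseRange_coe.exists_dist_lt (y i) hη
  refine ⟨n, fun i => φ i, fun i => c i • (show E from w i), fun x hx => ?_⟩
  have hx' (i : ℕ) : ‖φ i x‖ ≤ 1 := by
    have : dist (φ i 0) (φ i x) < 1 := hx i
    simpa using this.le
  refine ⟨fun i => hx' i, hpU _ ?_⟩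
  have hp_norm (v : E) : p v = ‖toLocalBanach p v‖ :=
    (UniformSpace.Completion.norm_coe (show WithSeminorm p from v)).symm
  have h_eq : toLocalBanach p (x - ∑ i : Fin n, φ i x • c i • (show E from w i)) =
      (toLocalBanach p x - ∑ i ∈ Finset.range n, (c i * φ i x) • y i) +
        ∑ i ∈ Finset.range n, (c i * φ i x) • (y i - (w i : LocalBanach p)) := by
    let T : WithSeminorm p →L[𝕜] LocalBanach p := UniformSpace.Completion.toComplL
    have h1 (v : E) : toLocalBanach p v = T v := rfl
    have h2 : T (x - ∑ i : Fin n, φ i x • c i • (show E from w i) : E) =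
        T x - ∑ i : Fin n, (c i * φ i x) • T (w i) := by
      erw [map_sub, map_sum]
      congr 1
      refine Finset.sum_congr rfl fun i _ => ?_
      erw [map_smul, map_smul]
      rw [smul_smul, mul_comm]
    rw [h1, h1, h2, Fin.sum_univ_eq_sum_range (fun i => (c i * φ i x) • T (w i))]
    simp only [smul_sub, Finset.sum_sub_distrib]
    have h3 (i : ℕ) : T (w i) = (w i : LocalBanach p) := rfl
    simp only [h3]
    abel
  have h_tail : ‖toLocalBanach p x - ∑ i ∈ Finset.range n, (c i * φ i x) • y i‖ < 1 / (2 * t) := by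
    refine lt_of_le_of_lt ?_ hn
    have hs : Summable fun i => ‖c (i + n)‖ * C :=
      (summable_nat_add_iff (f := fun i => ‖c i‖ * C) n).2 (hc.mul_right C)
    refine ((hasSum_nat_add_iff' n).2 (hsum x)).norm_le_of_bounded hs.hasSum fun i => ?_
    rw [norm_smul, norm_mul]
    have := mul_le_of_le_one_right (norm_nonneg (c (i + n))) (hx' (i + n))
    exact mul_le_mul this (hC _) (norm_nonneg _) (norm_nonneg _)
  have h_approx : ‖∑ i ∈ Finset.range n, (c i * φ i x) • (y i - (w i : LocalBanach p))‖ ≤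
      1 / (2 * t) := by
    have hc0 : 0 ≤ ∑' i, ‖c i‖ := tsum_nonneg fun i => norm_nonneg _
    calc _ ≤ ∑ i ∈ Finset.range n, ‖c i‖ * (1 / (2 * t * (∑' i, ‖c i‖ + 1))) := by
          refine norm_sum_le_of_le _ fun i _ => ?_
          rw [norm_smul, norm_mul]
          have := mul_le_of_le_one_right (norm_nonneg (c i)) (hx' i)
          refine mul_le_mul this ?_ (norm_nonneg _) (norm_nonneg _)
          rw [← dist_eq_norm]
          exact (hw i).le
      _ ≤ (∑' i, ‖c i‖) * (1 / (2 * t * (∑' i, ‖c i‖ + 1))) := by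
          rw [← Finset.sum_mul]
          gcongr
          exact hc.sum_le_tsum _ fun i _ => norm_nonneg _
      _ ≤ 1 / (2 * t) := by
          rw [mul_one_div, div_le_div_iff₀ (by positivity) (by positivity)]
          nlinarith
  rw [map_smul_eq_mul, hp_norm, h_eq, RCLike.norm_ofReal, abs_of_pos ht]
  calc _ ≤ t * (‖_‖ + ‖_‖) := by gcongr; exact norm_add_le _ _
    _ < t * (1 / (2 * t) + 1 / (2 * t)) :=
        mul_lt_mul_of_pos_left (add_lt_add_of_lt_of_le h_tail h_approx) ht
    _ = 1 := by field_simp; norm_num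

end LocallyConvex

/-! ### Bounded sets in the completed tensor product are totally bounded -/

section Bounded

variable {𝕜 : Type*} [RCLike 𝕜]
  {A : Type*} [AddCommGroup A] [Module 𝕜 A] [Module ℝ A] [IsScalarTower ℝ 𝕜 A]
  [TopologicalSpace A] [IsTopologicalAddGroup A] [ContinuousSMul 𝕜 A] [LocallyConvexSpace ℝ A]
  {B : Type*} [AddCommGroup B] [Module 𝕜 B] [Module ℝ B] [IsScalarTower ℝ 𝕜 B]
  [TopologicalSpace B] [IsTopologicalAddGroup B] [ContinuousSMul 𝕜 B] [LocallyConvexSpace ℝ B]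

open UniformSpace (Completion)

omit [Module ℝ A] [IsScalarTower ℝ 𝕜 A] [LocallyConvexSpace ℝ A] [Module ℝ B]
  [IsScalarTower ℝ 𝕜 B] [LocallyConvexSpace ℝ B] in
theorem CompletedTensor.closure_tensorHull_mem_nhds {U : Set A} (hU : U ∈ 𝓝 0) {V : Set B}
    (hV : V ∈ 𝓝 0) {r : ℝ} (hr : 0 < r) :
    closure ((↑) '' {z : ProjTensor 𝕜 A B | TensorHull U V r z}) ∈
      𝓝 (0 : CompletedTensor 𝕜 A B) := by
  rw [← Completion.coe_zero]
  exact Completion.isDenseInducing_coe.closure_image_mem_nhds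
    (ProjTensor.tensorHull_mem_nhds hU hV hr)

/-- The tensor product of two linear maps. -/
def ProjTensor.map {𝕜 A B : Type*} [RCLike 𝕜] [AddCommGroup A] [Module 𝕜 A] [AddCommGroup B]
    [Module 𝕜 B] (P : A →ₗ[𝕜] A) (Q : B →ₗ[𝕜] B) : ProjTensor 𝕜 A B →ₗ[𝕜] ProjTensor 𝕜 A B :=
  TensorProduct.map P Q

theorem ProjTensor.map_tmul {𝕜 A B : Type*} [RCLike 𝕜] [AddCommGroup A] [Module 𝕜 A]
    [AddCommGroup B] [Module 𝕜 B] (P : A →ₗ[𝕜] A) (Q : B →ₗ[𝕜] B) (a : A) (b : B) :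
    map P Q (tmul 𝕜 a b) = tmul 𝕜 (P a) (Q b) := TensorProduct.map_tmul P Q a b

/-- With `Pa = a - u/t` and `Qb = b - v/t`, the difference `a ⊗ b - Pa ⊗ Qb` equals `(u ⊗ b)/t + (a
⊗ v)/t - (u ⊗ v)/t²`. Since `t ≥ 1`, each of the three terms has weight at most `1/t`. -/
theorem TensorHull.sub_map {𝕜 A B : Type*} [RCLike 𝕜] [AddCommGroup A] [Module 𝕜 A]
    [AddCommGroup B] [Module 𝕜 B]
    {U U' : Set A} {V V' : Set B} (hU : U' ⊆ U) (hV : V' ⊆ V)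
    {t : ℝ} (ht : 1 ≤ t) (P : A →ₗ[𝕜] A) (Q : B →ₗ[𝕜] B)
    (hP : ∀ a ∈ U', (t : 𝕜) • (a - P a) ∈ U) (hQ : ∀ b ∈ V', (t : 𝕜) • (b - Q b) ∈ V)
    {r : ℝ} {z : ProjTensor 𝕜 A B} (hz : TensorHull U' V' r z) :
    TensorHull U V (3 / t * r) (z - ProjTensor.map P Q z) := by
  have ht0 : 0 < t := one_pos.trans_le ht
  have htne : (t : 𝕜) ≠ 0 := by exact_mod_cast ht0.ne'
  refine TensorHull.map (M := 3 / t) (LinearMap.id - ProjTensor.map P Q) (fun a ha b hb => ?_)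
    (by positivity) hz
  obtain ⟨u, hu, hPa⟩ : ∃ u ∈ U, P a = a - (t : 𝕜)⁻¹ • u :=
    ⟨_, hP a ha, by rw [inv_smul_smul₀ htne]; abel⟩
  obtain ⟨v, hv, hQb⟩ : ∃ v ∈ V, Q b = b - (t : 𝕜)⁻¹ • v :=
    ⟨_, hQ b hb, by rw [inv_smul_smul₀ htne]; abel⟩
  have key : (LinearMap.id - ProjTensor.map P Q : ProjTensor 𝕜 A B →ₗ[𝕜] ProjTensor 𝕜 A B)
      (.tmul 𝕜 a b) = (t : 𝕜)⁻¹ • ProjTensor.tmul 𝕜 u b + ((t : 𝕜)⁻¹ • ProjTensor.tmul 𝕜 a v +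
        (-((t : 𝕜)⁻¹ * (t : 𝕜)⁻¹)) • ProjTensor.tmul 𝕜 u v) := by
    have e1 : ProjTensor.tmul 𝕜 a b =
        ProjTensor.tmul 𝕜 (P a + (t : 𝕜)⁻¹ • u) (Q b + (t : 𝕜)⁻¹ • v) := by
      rw [hPa, hQb, sub_add_cancel, sub_add_cancel]
    have e2 : ProjTensor.tmul 𝕜 u b = ProjTensor.tmul 𝕜 u (Q b + (t : 𝕜)⁻¹ • v) := by
      rw [hQb, sub_add_cancel]
    have e3 : ProjTensor.tmul 𝕜 a v = ProjTensor.tmul 𝕜 (P a + (t : 𝕜)⁻¹ • u) v := by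
      rw [hPa, sub_add_cancel]
    rw [LinearMap.sub_apply, LinearMap.id_apply, ProjTensor.map_tmul, e1, e2, e3]
    simp only [ProjTensor.tmul_add_left, ProjTensor.tmul_add_right, ProjTensor.tmul_smul_left,
      ProjTensor.tmul_smul_right]
    module
  rw [key]
  have h := (TensorHull.smul_tmul (t : 𝕜)⁻¹ hu (hV hb)).add
    ((TensorHull.smul_tmul (t : 𝕜)⁻¹ (hU ha) hv).add
      (TensorHull.smul_tmul (-((t : 𝕜)⁻¹ * (t : 𝕜)⁻¹)) hu hv))
  refine h.mono_right ?_
  rw [norm_neg, norm_mul, norm_inv, RCLike.norm_ofReal, abs_of_pos ht0]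
  have : t⁻¹ * t⁻¹ ≤ t⁻¹ := mul_le_of_le_one_right (by positivity) (inv_le_one_of_one_le₀ ht)
  rw [div_eq_mul_inv]
  linarith

/-- The image of a hull under a tensor product of maps of finite rank is relatively compact. -/
theorem TensorHull.exists_map_eq_sum {𝕜 A B : Type*} [RCLike 𝕜] [AddCommGroup A] [Module 𝕜 A]
    [AddCommGroup B] [Module 𝕜 B] {ι κ : Type*} [Fintype ι] [Fintype κ] {U : Set A} {V : Set B}
    {P : A →ₗ[𝕜] A} {Q : B →ₗ[𝕜] B} {φ : ι → A → 𝕜} {ψ : κ → B → 𝕜} {d : ι → A} {e : κ → B}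
    (hP : ∀ a, P a = ∑ i, φ i a • d i) (hQ : ∀ b, Q b = ∑ j, ψ j b • e j)
    (hφ : ∀ a ∈ U, ∀ i, ‖φ i a‖ ≤ 1) (hψ : ∀ b ∈ V, ∀ j, ‖ψ j b‖ ≤ 1)
    {r : ℝ} {z : ProjTensor 𝕜 A B} (hz : TensorHull U V r z) :
    ∃ x : ι × κ → 𝕜, ‖x‖ ≤ r ∧
      ProjTensor.map P Q z = ∑ k, x k • ProjTensor.tmul 𝕜 (d k.1) (e k.2) := by
  induction hz with
  | zero hr => exact ⟨0, by simpa using hr, by simp⟩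
  | @cons r z c a b ha hb hz ih =>
    obtain ⟨x, hx, hxz⟩ := ih
    have hy : ‖fun k : ι × κ => φ k.1 a * ψ k.2 b‖ ≤ 1 :=
      (pi_norm_le_iff_of_nonneg zero_le_one).2 fun k => by
        rw [norm_mul]
        exact mul_le_one₀ (hφ a ha _) (norm_nonneg _) (hψ b hb _)
    refine ⟨(c • fun k => φ k.1 a * ψ k.2 b) + x, ?_, ?_⟩
    · refine (norm_add_le _ _).trans (add_le_add ?_ hx)
      rw [norm_smul]
      exact mul_le_of_le_one_right (norm_nonneg c) hy
    · have h : ProjTensor.tmul 𝕜 (P a) (Q b) =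
          ∑ k : ι × κ, (φ k.1 a * ψ k.2 b) • ProjTensor.tmul 𝕜 (d k.1) (e k.2) := by
        change ProjTensor.mk₂ (P a) (Q b) = ∑ k : ι × κ, _ • ProjTensor.mk₂ (d k.1) (e k.2)
        rw [hP, hQ, Fintype.sum_prod_type]
        simp only [map_sum, map_smul, LinearMap.sum_apply, LinearMap.smul_apply, Finset.smul_sum,
          smul_smul]
        rw [Finset.sum_comm]
        refine Finset.sum_congr rfl fun i _ => Finset.sum_congr rfl fun j _ => ?_
        rw [mul_comm]
      rw [map_add, map_smul, ProjTensor.map_tmul, h, hxz]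
      simp [add_smul, Finset.sum_add_distrib, Finset.smul_sum, smul_smul]

theorem CompletedTensor.exists_sub_mem_of_mem_closure {𝕜 A B : Type*} [RCLike 𝕜] [AddCommGroup A]
    [Module 𝕜 A] [TopologicalSpace A] [AddCommGroup B] [Module 𝕜 B] [TopologicalSpace B]
    {T : Set (ProjTensor 𝕜 A B)} {s : CompletedTensor 𝕜 A B} (hs : s ∈ closure ((↑) '' T))
    {O : Set (CompletedTensor 𝕜 A B)} (hO : O ∈ 𝓝 0) :
    ∃ z ∈ T, s - (z : CompletedTensor 𝕜 A B) ∈ O := by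
  have h : Filter.Tendsto (fun z => s - z) (𝓝 s) (𝓝 0) := by
    simpa using (continuous_const.sub continuous_id).tendsto (f := fun z => s - z) s
  obtain ⟨_, hzO, z, hz, rfl⟩ := mem_closure_iff_nhds.1 hs _ (h hO)
  exact ⟨z, hz, hzO⟩

/-- Bounded subsets of the completed tensor product of nuclear spaces are totally bounded. -/
theorem CompletedTensor.exists_finite_cover (hA : IsNuclearSpace 𝕜 A) (hB : IsNuclearSpace 𝕜 B)
    {S : Set (CompletedTensor 𝕜 A B)} (hS : Bornology.IsVonNBounded 𝕜 S)
    {W : Set (CompletedTensor 𝕜 A B)} (hW : W ∈ 𝓝 0) :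
    ∃ F : Set (ProjTensor 𝕜 A B), F.Finite ∧
      ∀ s ∈ S, ∃ t ∈ F, s - (t : CompletedTensor 𝕜 A B) ∈ W := by
  obtain ⟨O, hO, hOW⟩ := exists_nhds_zero_quarter hW
  have hO' : ((↑) : ProjTensor 𝕜 A B → CompletedTensor 𝕜 A B) ⁻¹' O ∈ 𝓝 0 :=
    (Completion.continuous_coe _).continuousAt.preimage_mem_nhds
      (by rwa [Completion.coe_zero])
  obtain ⟨U, hU, V, hV, hUV⟩ := ProjTensor.exists_tensorHull_subset hO'
  obtain ⟨U', hU', hPU⟩ := hA.exists_finiteRank hU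
  obtain ⟨V', hV', hQV⟩ := hB.exists_finiteRank hV
  -- The scalar `c` depends on `U'` and `V'`, and the accuracy `t` of the approximation must be
  -- adapted to `c`. There is no circle because `U'` and `V'` serve every `t`.
  obtain ⟨c, hcS, hc0⟩ := ((hS (closure_tensorHull_mem_nhds (Filter.inter_mem hU' hU)
    (Filter.inter_mem hV' hV) one_pos)).and (Bornology.eventually_ne_cobounded 0)).exists
  -- The factor `3‖c‖` brings the weight `3 / t * ‖c‖` from `TensorHull.sub_map` down to at most
  -- `1`.
  have ht : 1 ≤ max 1 (3 * ‖c‖) := le_max_left _ _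
  obtain ⟨m, φ, d, hφ⟩ := hPU _ (one_pos.trans_le ht)
  obtain ⟨n, ψ, e, hψ⟩ := hQV _ (one_pos.trans_le ht)
  let P : A →ₗ[𝕜] A := ∑ i, (φ i).toLinearMap.smulRight (d i)
  let Q : B →ₗ[𝕜] B := ∑ j, (ψ j).toLinearMap.smulRight (e j)
  have hP (a : A) : P a = ∑ i, φ i a • d i := by simp [P]
  have hQ (b : B) : Q b = ∑ j, ψ j b • e j := by simp [Q]
  have hK : IsCompact ((fun x : Fin m × Fin n → 𝕜 =>
      ∑ k, x k • ProjTensor.tmul 𝕜 (d k.1) (e k.2)) '' Metric.closedBall 0 ‖c‖) :=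
    (isCompact_closedBall 0 ‖c‖).image (by fun_prop)
  obtain ⟨F, hF, hKF⟩ := totallyBounded_iff_subset_finite_iUnion_nhds_zero.1 hK.totallyBounded _ hO'
  refine ⟨F, hF, fun s hs => ?_⟩
  obtain ⟨s, hs', rfl⟩ := hcS hs
  obtain ⟨z, hz, hzO⟩ := exists_sub_mem_of_mem_closure hs' (preimage_smul_mem_nhds_zero hO c)
  have hcz : TensorHull (U' ∩ U) (V' ∩ V) ‖c‖ (c • z) := by
    simpa using TensorHull.smul c hz
  obtain ⟨x, hx, hxz⟩ := hcz.exists_map_eq_sum hP hQ (fun a ha => (hφ a ha.1).1)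
    (fun b hb => (hψ b hb.1).1)
  obtain ⟨t, htF, hxt⟩ := Set.mem_iUnion₂.1 (hKF ⟨x, by simpa using hx, rfl⟩)
  obtain ⟨o, ho, hto⟩ := hxt
  refine ⟨t, htF, ?_⟩
  have h_sub : TensorHull U V 1 (c • z - ProjTensor.map P Q (c • z)) := by
    refine (hcz.sub_map Set.inter_subset_right Set.inter_subset_right ht P Q ?_ ?_).mono_right ?_
    · intro a ha; rw [hP]; exact (hφ a ha.1).2
    · intro b hb; rw [hQ]; exact (hψ b hb.1).2
    · rw [div_mul_eq_mul_div]
      exact div_le_one_of_le₀ (le_max_right _ _) (by positivity)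
  -- The three errors come from density of `A ⊗ B`, from the finite-rank approximation and from the
  -- finite net in finite dimensions. The summand `0` fills the fourth slot of `hOW`.
  have h_eq : c • s - (t : CompletedTensor 𝕜 A B) = c • (s - z) +
      ((c • z - ProjTensor.map P Q (c • z) : ProjTensor 𝕜 A B) : CompletedTensor 𝕜 A B) +
      (o : CompletedTensor 𝕜 A B) + 0 := by
    have hto' : ProjTensor.map P Q (c • z) = t + o := hxz.trans hto.symm
    rw [hto', Completion.coe_sub, Completion.coe_add, Completion.coe_smul, smul_sub]
    abel
  simp only
  rw [h_eq]
  exact hOW hzO (hUV _ h_sub) ho (mem_of_mem_nhds hO)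

end Bounded

/-! ### Totally bounded sets of tensors and compact sets in the factors -/

/-- Finite sets that shrink to `0`, together with `0`, form a compact set. -/
theorem isCompact_insert_zero_iUnion {E : Type*} [TopologicalSpace E] [Zero E] {F : ℕ → Set E}
    (hF : ∀ k, (F k).Finite) (h : ∀ W ∈ 𝓝 (0 : E), ∀ᶠ k in Filter.atTop, F k ⊆ W) :
    IsCompact (insert 0 (⋃ k, F k)) := by
  refine isCompact_iff_ultrafilter_le_nhds'.2 fun f hf => ?_
  -- An ultrafilter containing some `F k` converges in that finite set. One containing none avoids
  -- `F 0, …, F (n - 1)` for every `n`, so it tends to `0`.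
  by_cases hk : ∃ k, F k ∈ f
  · obtain ⟨k, hk⟩ := hk
    obtain ⟨x, hx, hfx⟩ := (hF k).isCompact.ultrafilter_le_nhds' f hk
    exact ⟨x, Or.inr (Set.mem_iUnion.2 ⟨k, hx⟩), hfx⟩
  · refine ⟨0, Set.mem_insert _ _, fun W hW => ?_⟩
    obtain ⟨n, hn⟩ := Filter.eventually_atTop.1 (h W hW)
    have hfin : ∀ᶠ x in (f : Filter E), ∀ k ∈ Finset.range n, x ∉ F k :=
      (Filter.eventually_all_finset _).2 fun k _ =>
        Ultrafilter.compl_mem_iff_notMem.2 fun hkf => hk ⟨k, hkf⟩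
    filter_upwards [hfin, hf] with x hx hxF
    rcases hxF with rfl | hxF
    · exact mem_of_mem_nhds hW
    · obtain ⟨k, hxk⟩ := Set.mem_iUnion.1 hxF
      exact hn k (not_lt.1 fun hkn => hx k (Finset.mem_range.2 hkn) hxk) hxk

section

variable {𝕜 : Type*} [RCLike 𝕜]
  {A : Type*} [AddCommGroup A] [Module 𝕜 A]
  [TopologicalSpace A] [IsTopologicalAddGroup A] [ContinuousSMul 𝕜 A]
  {B : Type*} [AddCommGroup B] [Module 𝕜 B]
  [TopologicalSpace B] [IsTopologicalAddGroup B] [ContinuousSMul 𝕜 B]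

open UniformSpace (Completion)

omit [IsTopologicalAddGroup A] [ContinuousSMul 𝕜 A] [IsTopologicalAddGroup B]
  [ContinuousSMul 𝕜 B] in
theorem CompletedTensor.exists_closure_tensorHull_subset {W : Set (CompletedTensor 𝕜 A B)}
    (hW : W ∈ 𝓝 0) :
    ∃ U ∈ 𝓝 (0 : A), ∃ V ∈ 𝓝 (0 : B),
      closure ((↑) '' {z : ProjTensor 𝕜 A B | TensorHull U V 1 z}) ⊆ W := by
  obtain ⟨C, hC, hCc, hCW⟩ := exists_mem_nhds_isClosed_subset hW
  have hC' : ((↑) : ProjTensor 𝕜 A B → CompletedTensor 𝕜 A B) ⁻¹' C ∈ 𝓝 0 :=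
    (Completion.continuous_coe _).continuousAt.preimage_mem_nhds
      (by rwa [Completion.coe_zero])
  obtain ⟨U, hU, V, hV, h⟩ := ProjTensor.exists_tensorHull_subset hC'
  exact ⟨U, hU, V, hV, (closure_minimal (Set.image_subset_iff.2 h) hCc).trans hCW⟩

variable [FirstCountableTopology A] [FirstCountableTopology B]

/-- A set in the completed tensor product of metrizable spaces which is totally bounded is
contained in the closed absolutely convex hull of `K ⊗ L` for compact sets `K` and `L`. -/
theorem CompletedTensor.exists_isCompact_subset_closure {S : Set (CompletedTensor 𝕜 A B)}
    (hS : ∀ W ∈ 𝓝 (0 : CompletedTensor 𝕜 A B), ∃ F : Set (ProjTensor 𝕜 A B), F.Finite ∧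
      ∀ s ∈ S, ∃ t ∈ F, s - (t : CompletedTensor 𝕜 A B) ∈ W) :
    ∃ (K : Set A) (L : Set B), IsCompact K ∧ IsCompact L ∧
      S ⊆ closure ((↑) '' {z : ProjTensor 𝕜 A B | TensorHull K L 1 z}) := by
  obtain ⟨u, hu⟩ := (𝓝 (0 : A)).exists_antitone_basis
  obtain ⟨v, hv⟩ := (𝓝 (0 : B)).exists_antitone_basis
  -- The sum of all `r k` is `1/2`; the other half of the total weight `1` is reserved for the first
  -- approximation.
  let r (k : ℕ) : ℝ := (1 / 2) * (1 / 2) ^ (k + 1)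
  have hr (k : ℕ) : 0 < r k := by positivity
  -- Since `A ⊗ B` carries the topology induced by its completion, the difference of two small
  -- elements of the completion is a small tensor whenever it lies in `A ⊗ B`.
  have hO (k : ℕ) : ∃ O ∈ 𝓝 (0 : CompletedTensor 𝕜 A B),
      O ⊆ closure ((↑) '' {z : ProjTensor 𝕜 A B | TensorHull (u k) (v k) 1 z}) ∧
      ∀ x ∈ O, ∀ y ∈ O, ∀ d : ProjTensor 𝕜 A B, d = x - y → TensorHull (u k) (v k) (r k) d := by
    have hD := ProjTensor.tensorHull_mem_nhds (𝕜 := 𝕜) (hu.mem k) (hv.mem k) (hr k)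
    rw [Completion.isDenseInducing_coe.isInducing.nhds_eq_comap, Completion.coe_zero,
      Filter.mem_comap] at hD
    obtain ⟨N, hN, hND⟩ := hD
    obtain ⟨O, hO, hON⟩ := exists_nhds_half_neg hN
    refine ⟨_, Filter.inter_mem hO (closure_tensorHull_mem_nhds (hu.mem k) (hv.mem k) one_pos),
      Set.inter_subset_right, fun x hx y hy d hd => hND ?_⟩
    rw [Set.mem_preimage, hd]
    exact hON _ hx.1 _ hy.1
  choose O hO hOcl hOsub using hO
  -- Consecutive approximations `t k`, `t (k + 1)` must both be `O k`-close to `s`, so the net `F (k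
  -- + 1)` has to respect `O k` too. For `k = 0` truncated subtraction just repeats `O 0`.
  choose F hF hFS using fun k => hS _ (Filter.inter_mem (hO k) (hO (k - 1)))
  obtain ⟨G₀, H₀, hG₀, hH₀, -, -, h₀⟩ := TensorHull.exists_finite_of_finite (hF 0)
    fun z _ => TensorHull.univ z one_half_pos
  -- Only finitely many increments `t (k + 1) - t k` can occur as `s` varies. They are sums over
  -- finite sets `G k ⊆ u k` and `H k ⊆ v k`, which shrink to `0`; hence `K` and `L` are compact.
  have hdiff (k : ℕ) :
      (Set.image2 (· - ·) (F (k + 1)) (F k) ∩ {d | TensorHull (u k) (v k) (r k) d}).Finite :=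
    ((hF _).image2 _ (hF _)).inter_of_left _
  choose G H hG hH hGu hHv hGH using fun k =>
    TensorHull.exists_finite_of_finite (hdiff k) fun d hd => hd.2
  let K := G₀ ∪ insert 0 (⋃ k, G k)
  let L := H₀ ∪ insert 0 (⋃ k, H k)
  have hGK (k : ℕ) : G k ⊆ K := fun x hx => Or.inr (Or.inr (Set.mem_iUnion.2 ⟨k, hx⟩))
  have hHL (k : ℕ) : H k ⊆ L := fun x hx => Or.inr (Or.inr (Set.mem_iUnion.2 ⟨k, hx⟩))
  refine ⟨K, L, hG₀.isCompact.union (isCompact_insert_zero_iUnion hG fun W hW => ?_),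
    hH₀.isCompact.union (isCompact_insert_zero_iUnion hH fun W hW => ?_), fun s hs => ?_⟩
  · exact (hu.eventually_subset hW).mono fun k hk => (hGu k).trans hk
  · exact (hv.eventually_subset hW).mono fun k hk => (hHv k).trans hk
  choose t htF ht using fun k => hFS k s hs
  have hstep (k : ℕ) : TensorHull K L (r k) (t (k + 1) - t k) := by
    refine (hGH k _ ⟨Set.mem_image2_of_mem (htF _) (htF _), ?_⟩).mono (hGK k) (hHL k)
    exact hOsub k _ (ht k).1 _ (ht (k + 1)).2 _ (by rw [Completion.coe_sub]; abel)
  have hpartial (n : ℕ) : TensorHull K L (1 - (1 / 2) ^ (n + 1)) (t n) := by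
    induction n with
    | zero =>
      refine ((h₀ _ (htF 0)).mono Set.subset_union_left Set.subset_union_left).mono_right ?_
      norm_num
    | succ n ih =>
      have := ih.add (hstep n)
      rw [add_sub_cancel] at this
      refine this.mono_right (le_of_eq ?_)
      simp only [r, pow_succ]
      ring
  have hlim : Filter.Tendsto (fun n => (t n : CompletedTensor 𝕜 A B)) Filter.atTop (𝓝 s) := by
    have h0 : Filter.Tendsto (fun n => s - (t n : CompletedTensor 𝕜 A B)) Filter.atTop (𝓝 0) := by
      refine Filter.tendsto_def.2 fun W hW => ?_
      obtain ⟨U, hU, V, hV, hUV⟩ := exists_closure_tensorHull_subset hW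
      filter_upwards [hu.eventually_subset hU, hv.eventually_subset hV] with n hn hn'
      refine hUV (closure_mono (Set.image_mono fun z hz => ?_) (hOcl n (ht n).1))
      exact hz.mono hn hn'
    simpa using (tendsto_const_nhds (x := s)).sub h0
  refine mem_closure_of_tendsto hlim (Filter.Eventually.of_forall fun n => ⟨t n, ?_, rfl⟩)
  exact (hpartial n).mono_right (by have : (0 : ℝ) ≤ (1 / 2) ^ (n + 1) := by positivity
                                    linarith)

end

/-! ### The dual `H'_c` and equicontinuous sets -/

section Dual

variable {𝕜 : Type*} [RCLike 𝕜]
  {H : Type*} [AddCommGroup H] [Module 𝕜 H] [Module ℝ H] [TopologicalSpace H]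

instance : ContinuousLinearMapClass (DualC 𝕜 H) 𝕜 H 𝕜 :=
  inferInstanceAs (ContinuousLinearMapClass
    (UniformConvergenceCLM (RingHom.id 𝕜) 𝕜 (absConvexCompacts 𝕜 H)) 𝕜 H 𝕜)

instance : IsTopologicalAddGroup (DualC 𝕜 H) :=
  inferInstanceAs (IsTopologicalAddGroup
    (UniformConvergenceCLM (RingHom.id 𝕜) 𝕜 (absConvexCompacts 𝕜 H)))

theorem DualC.ext {φ ψ : DualC 𝕜 H} (h : ∀ x, φ x = ψ x) : φ = ψ := DFunLike.ext φ ψ h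

theorem DualC.tendsto_zero_iff {ι : Type*} {F : ι → DualC 𝕜 H} {l : Filter ι} :
    Filter.Tendsto F l (𝓝 0) ↔
      ∀ C ∈ absConvexCompacts 𝕜 H, ∀ ε > 0, ∀ᶠ i in l, ∀ x ∈ C, ‖F i x‖ < ε := by
  have h := UniformConvergenceCLM.tendsto_iff_tendstoUniformlyOn (σ := RingHom.id 𝕜) (F := 𝕜)
    (absConvexCompacts 𝕜 H) (a := F) (a₀ := 0) (p := l)
  refine h.trans (forall₂_congr fun C _ => Metric.tendstoUniformlyOn_iff.trans ?_)
  have h0 (x : H) :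
      (0 : UniformConvergenceCLM (RingHom.id 𝕜) 𝕜 (absConvexCompacts 𝕜 H)) x = 0 := rfl
  simp only [h0, dist_zero_left]
  rfl

theorem mem_equicontinuousSets_iff [IsTopologicalAddGroup H] {X : Set (DualC 𝕜 H)} :
    X ∈ equicontinuousSets 𝕜 H ↔ ∀ ε > 0, ∀ᶠ x in 𝓝 (0 : H), ∀ φ ∈ X, ‖φ x‖ < ε := by
  have h0 : X ∈ equicontinuousSets 𝕜 H ↔
      EquicontinuousAt (fun (φ : X) (x : H) => φ.1 x) 0 :=
    ⟨fun h => h 0, fun h => equicontinuous_of_equicontinuousAt_zero (fun φ : X => φ.1) h⟩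
  rw [h0, Metric.equicontinuousAt_iff_right]
  simp

theorem singleton_mem_equicontinuousSets [IsTopologicalAddGroup H] (φ : DualC 𝕜 H) :
    {φ} ∈ equicontinuousSets 𝕜 H := by
  refine mem_equicontinuousSets_iff.2 fun ε hε => ?_
  have h : Filter.Tendsto φ (𝓝 0) (𝓝 0) := by
    simpa using (map_continuous φ).tendsto 0
  simpa using NormedAddGroup.tendsto_nhds_zero.1 h ε hε

/-- A compact set is absorbed by the `0`-neighbourhood on which all of `X` is smaller than `1`, and
the absorbing scalar gives the bound. -/
theorem isVonNBounded_of_mem_equicontinuousSets [IsTopologicalAddGroup H] [ContinuousSMul 𝕜 H]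
    {X : Set (DualC 𝕜 H)} (hX : X ∈ equicontinuousSets 𝕜 H) : Bornology.IsVonNBounded 𝕜 X := by
  refine UniformConvergenceCLM.isVonNBounded_iff.2 fun C hC => ?_
  rw [NormedSpace.isVonNBounded_iff, isBounded_iff_forall_norm_le]
  obtain ⟨c, hc⟩ := (hC.2.2.isVonNBounded 𝕜 (mem_equicontinuousSets_iff.1 hX 1 one_pos)).exists
  refine ⟨‖c‖, ?_⟩
  rintro _ ⟨φ, hφ, x, hx, rfl⟩
  obtain ⟨y, hy, rfl⟩ := hc hx
  have h : ‖φ (c • y)‖ ≤ ‖c‖ := by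
    rw [map_smul, norm_smul]
    exact mul_le_of_le_one_right (norm_nonneg c) (hy φ hφ).le
  exact h

/-- In a complete space, a compact set lies in an absolutely convex compact set. -/
theorem exists_absConvexCompacts_superset {H : Type*} [AddCommGroup H] [Module 𝕜 H] [Module ℝ H]
    [IsScalarTower ℝ 𝕜 H] [UniformSpace H] [IsUniformAddGroup H] [ContinuousSMul 𝕜 H]
    [LocallyConvexSpace ℝ H] [CompleteSpace H] {K : Set H} (hK : IsCompact K) :
    ∃ C ∈ absConvexCompacts 𝕜 H, K ⊆ C := by
  have : ContinuousSMul ℝ H := IsScalarTower.continuousSMul 𝕜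
  have hbal : Balanced 𝕜 (balancedHull 𝕜 K) := balancedHull.balanced K
  have hcomp : IsCompact (balancedHull 𝕜 K) := by
    have h : balancedHull 𝕜 K = (fun p : 𝕜 × H => p.1 • p.2) '' (Metric.closedBall 0 1 ×ˢ K) := by
      ext x
      simp only [mem_balancedHull_iff, Set.mem_smul_set, Set.mem_image, Set.mem_prod, Prod.exists,
        mem_closedBall_zero_iff]
      exact ⟨fun ⟨r, hr, y, hy, h⟩ => ⟨r, y, ⟨hr, hy⟩, h⟩,
        fun ⟨r, y, ⟨hr, hy⟩, h⟩ => ⟨r, hr, y, hy, h⟩⟩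
    rw [h]
    exact ((isCompact_closedBall 0 1).prod hK).image continuous_smul
  refine ⟨closure (convexHull ℝ (balancedHull 𝕜 K)), ⟨(balanced_convexHull hbal).closure,
    (convex_convexHull ℝ _).closure, ?_⟩, (subset_balancedHull 𝕜).trans
      ((subset_convexHull ℝ _).trans subset_closure)⟩
  -- Completeness of `M₂` and `N₂` enters the theorem only here.
  exact (totallyBounded_convexHull.2 hcomp.totallyBounded).closure.isCompact_of_isClosed
    isClosed_closure

end Dual

/-! ### Topology and boundedness in the ε-product -/

section Eps

variable {𝕜 : Type*} [RCLike 𝕜]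
  {H : Type*} [AddCommGroup H] [Module 𝕜 H] [Module ℝ H] [TopologicalSpace H]
  {K : Type*} [AddCommGroup K] [Module 𝕜 K] [Module ℝ K] [TopologicalSpace K]

theorem EpsProduct.ext {u v : EpsProduct 𝕜 H K} (h : ∀ φ ψ, u.form φ ψ = v.form φ ψ) : u = v :=
  Subtype.ext (LinearMap.ext₂ h)

theorem EpsProduct.form_add (u v : EpsProduct 𝕜 H K) : (u + v).form = u.form + v.form := rfl

theorem EpsProduct.form_smul (c : 𝕜) (u : EpsProduct 𝕜 H K) : (c • u).form = c • u.form := rfl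

instance : IsTopologicalAddGroup (EpsProduct 𝕜 H K) :=
  topologicalAddGroup_induced (AddMonoidHom.mk' (fun u : EpsProduct 𝕜 H K =>
    UniformOnFun.ofFun
      (Set.image2 (fun X Y => X ×ˢ Y) (equicontinuousSets 𝕜 H) (equicontinuousSets 𝕜 K))
      fun p : DualC 𝕜 H × DualC 𝕜 K => u.form p.1 p.2) fun _ _ => rfl)

theorem EpsProduct.tendsto_zero_iff {ι : Type*} {F : ι → EpsProduct 𝕜 H K} {l : Filter ι} :
    Filter.Tendsto F l (𝓝 0) ↔
      ∀ X ∈ equicontinuousSets 𝕜 H, ∀ Y ∈ equicontinuousSets 𝕜 K, ∀ ε > 0,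
        ∀ᶠ i in l, ∀ φ ∈ X, ∀ ψ ∈ Y, ‖(F i).form φ ψ‖ < ε := by
  rw [(Topology.IsInducing.mk rfl : Topology.IsInducing (fun u : EpsProduct 𝕜 H K =>
    UniformOnFun.ofFun
      (Set.image2 (fun X Y => X ×ˢ Y) (equicontinuousSets 𝕜 H) (equicontinuousSets 𝕜 K))
      fun p : DualC 𝕜 H × DualC 𝕜 K => u.form p.1 p.2)).tendsto_nhds_iff,
    UniformOnFun.tendsto_iff_tendstoUniformlyOn, Set.forall_mem_image2]
  refine forall₂_congr fun X _ => forall₂_congr fun Y _ => Metric.tendstoUniformlyOn_iff.trans ?_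
  refine forall₂_congr fun ε _ => Filter.eventually_congr (Filter.Eventually.of_forall fun i => ?_)
  have h (p : DualC 𝕜 H × DualC 𝕜 K) : (0 : EpsProduct 𝕜 H K).form p.1 p.2 = 0 := rfl
  simp only [h, Set.mem_prod, Prod.forall, dist_zero_left, and_imp, Function.comp_apply,
    UniformOnFun.toFun_ofFun]
  exact forall_congr' fun φ => forall_comm

theorem EpsProduct.eventually_nhds_zero {X : Set (DualC 𝕜 H)} (hX : X ∈ equicontinuousSets 𝕜 H)
    {Y : Set (DualC 𝕜 K)} (hY : Y ∈ equicontinuousSets 𝕜 K) {ε : ℝ} (hε : 0 < ε) :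
    ∀ᶠ u in 𝓝 (0 : EpsProduct 𝕜 H K), ∀ φ ∈ X, ∀ ψ ∈ Y, ‖u.form φ ψ‖ < ε :=
  tendsto_zero_iff.1 Filter.tendsto_id X hX Y hY ε hε

theorem EpsProduct.exists_bound_of_isVonNBounded {T : Set (EpsProduct 𝕜 H K)}
    (hT : Bornology.IsVonNBounded 𝕜 T) {X : Set (DualC 𝕜 H)} (hX : X ∈ equicontinuousSets 𝕜 H)
    {Y : Set (DualC 𝕜 K)} (hY : Y ∈ equicontinuousSets 𝕜 K) :
    ∃ M, ∀ u ∈ T, ∀ φ ∈ X, ∀ ψ ∈ Y, ‖u.form φ ψ‖ ≤ M := by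
  obtain ⟨c, hc⟩ := (hT (eventually_nhds_zero hX hY one_pos)).exists
  refine ⟨‖c‖, fun u hu φ hφ ψ hψ => ?_⟩
  obtain ⟨v, hv, rfl⟩ := hc hu
  simp only [form_smul, LinearMap.smul_apply, norm_smul]
  exact mul_le_of_le_one_right (norm_nonneg c) (hv φ hφ ψ hψ).le

/-- Hypocontinuity bounds `u` on `X × V` for some `0`-neighbourhood `V` of `K'_c`, and `V` absorbs
the bounded set `Y`. -/
theorem EpsProduct.exists_bound [IsTopologicalAddGroup K] [ContinuousSMul 𝕜 K]
    (u : EpsProduct 𝕜 H K) {X : Set (DualC 𝕜 H)}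
    (hX : X ∈ equicontinuousSets 𝕜 H) {Y : Set (DualC 𝕜 K)} (hY : Y ∈ equicontinuousSets 𝕜 K) :
    ∃ M, ∀ φ ∈ X, ∀ ψ ∈ Y, ‖u.form φ ψ‖ ≤ M := by
  obtain ⟨V, hV, h⟩ := u.2.hypo_left X hX _ (Metric.ball_mem_nhds 0 one_pos)
  obtain ⟨c, hc⟩ := (isVonNBounded_of_mem_equicontinuousSets hY hV).exists
  refine ⟨‖c‖, fun φ hφ ψ hψ => ?_⟩
  obtain ⟨v, hv, rfl⟩ := hc hψ
  simp only [map_smul, norm_smul]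
  exact mul_le_of_le_one_right (norm_nonneg c) (mem_ball_zero_iff.1 (h φ hφ v hv)).le

theorem EpsProduct.continuous_form_apply [IsTopologicalAddGroup H] [IsTopologicalAddGroup K]
    (φ : DualC 𝕜 H) (ψ : DualC 𝕜 K) : Continuous fun u : EpsProduct 𝕜 H K => u.form φ ψ := by
  let ev : EpsProduct 𝕜 H K →+ 𝕜 := AddMonoidHom.mk' (fun u => u.form φ ψ) fun _ _ => rfl
  refine continuous_of_continuousAt_zero ev ?_
  rw [ContinuousAt, map_zero, NormedAddGroup.tendsto_nhds_zero]
  intro ε hε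
  filter_upwards [eventually_nhds_zero (singleton_mem_equicontinuousSets φ)
    (singleton_mem_equicontinuousSets ψ) hε] with u hu
  exact hu φ rfl ψ rfl

end Eps

/-! ### Hypocontinuous maps on compact sets, and equicontinuity in metrizable spaces -/

section Bilinear

variable {𝕜 : Type*} [RCLike 𝕜]
  {E : Type*} [AddCommGroup E] [Module 𝕜 E] [TopologicalSpace E] [IsTopologicalAddGroup E]
  {F : Type*} [AddCommGroup F] [Module 𝕜 F] [TopologicalSpace F] [IsTopologicalAddGroup F]
  {G : Type*} [AddCommGroup G] [Module 𝕜 G] [TopologicalSpace G] [IsTopologicalAddGroup G]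

/-- A hypocontinuous bilinear map is continuous on `K × C` if `K` and `C` are compact. -/
theorem IsHypocontinuous.isCompact_image2 [ContinuousSMul 𝕜 E] {f : E →ₗ[𝕜] F →ₗ[𝕜] G}
    (hf : IsHypocontinuous f) {K : Set E} (hK : IsCompact K) {C : Set F} (hC : IsCompact C) :
    IsCompact (Set.image2 (fun x y => f x y) K C) := by
  have : ContinuousOn (fun p : E × F => f p.1 p.2) (K ×ˢ C) := by
    rintro ⟨x, y⟩ ⟨hx, hy⟩
    -- The decomposition is `f(x', y') = f(x', y' - y) + f(x' - x, y) + f(x, y)`. The first term is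
    -- small by hypocontinuity, `K` being bounded, the second by separate continuity.
    have h₁ : Filter.Tendsto (fun p : E × F => f p.1 (p.2 - y)) (𝓝[K ×ˢ C] (x, y)) (𝓝 0) := by
      refine Filter.tendsto_def.2 fun W hW => ?_
      obtain ⟨V, hV, hVW⟩ := hf.hypo_left K (hK.isVonNBounded 𝕜) W hW
      have h : Filter.Tendsto (fun p : E × F => p.2 - y) (𝓝[K ×ˢ C] (x, y)) (𝓝 0) := by
        have : Continuous fun p : E × F => p.2 - y := by fun_prop
        simpa using (this.tendsto (x, y)).mono_left nhdsWithin_le_nhds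
      filter_upwards [h hV, self_mem_nhdsWithin] with p hp hpK
      exact hVW _ hpK.1 _ hp
    have h₂ : Filter.Tendsto (fun p : E × F => f (p.1 - x) y) (𝓝[K ×ˢ C] (x, y)) (𝓝 0) := by
      have : Continuous fun p : E × F => f (p.1 - x) y :=
        (hf.continuous_left y).comp (continuous_fst.sub continuous_const)
      simpa using (this.tendsto (x, y)).mono_left nhdsWithin_le_nhds
    have h := (h₁.add h₂).add_const (f x y)
    rw [add_zero, zero_add] at h
    refine h.congr fun p => ?_
    simp only [map_sub, LinearMap.sub_apply]
    abel
  rw [← Set.image_prod]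
  exact (hK.prod hC).image_of_continuousOn this

end Bilinear

/-- In a metrizable space, a family of bilinear forms that is uniformly bounded on products of
bounded sets is equicontinuous at `0`. -/
theorem exists_nhds_norm_le_of_bounded {𝕜 : Type*} [RCLike 𝕜]
    {A : Type*} [AddCommGroup A] [Module 𝕜 A] [TopologicalSpace A] [IsTopologicalAddGroup A]
    [ContinuousSMul 𝕜 A] [FirstCountableTopology A]
    {B : Type*} [AddCommGroup B] [Module 𝕜 B] [TopologicalSpace B] [IsTopologicalAddGroup B]
    [ContinuousSMul 𝕜 B] [FirstCountableTopology B]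
    {I : Type*} {Φ : I → A →ₗ[𝕜] B →ₗ[𝕜] 𝕜}
    (h : ∀ K : Set A, Bornology.IsVonNBounded 𝕜 K → ∀ L : Set B, Bornology.IsVonNBounded 𝕜 L →
      ∃ M, ∀ i, ∀ a ∈ K, ∀ b ∈ L, ‖Φ i a b‖ ≤ M) {ε : ℝ} (hε : 0 < ε) :
    ∃ U ∈ 𝓝 (0 : A), ∃ V ∈ 𝓝 (0 : B), ∀ i, ∀ a ∈ U, ∀ b ∈ V, ‖Φ i a b‖ ≤ ε := by
  by_contra! hcon
  obtain ⟨u, hu⟩ := (𝓝 (0 : A)).exists_antitone_basis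
  obtain ⟨v, hv⟩ := (𝓝 (0 : B)).exists_antitone_basis
  -- If the claim fails, there are `a n`, `b n` with `n • a n → 0`, `b n → 0` and `|Φ (a n, b n)| >
  -- ε`. Both null sequences are bounded, but the forms at `(n • a n, b n)` exceed `n ε` for `n ≥
  -- 1`.
  choose i a ha b hb hab using fun n : ℕ =>
    hcon _ (preimage_smul_mem_nhds_zero (hu.mem n) (n : 𝕜)) _ (hv.mem n)
  obtain ⟨M, hM⟩ := h _ ((hu.tendsto ha).isVonNBounded_range 𝕜) _
    ((hv.tendsto hb).isVonNBounded_range 𝕜)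
  obtain ⟨n, hn⟩ := exists_nat_gt (M / ε)
  have h₁ := hM (i n) _ (Set.mem_range_self n) _ (Set.mem_range_self n)
  rw [map_smul, LinearMap.smul_apply, norm_smul, RCLike.norm_natCast] at h₁
  have h₂ : (n : ℝ) * ε ≤ n * ‖Φ (i n) (a n) (b n)‖ := by gcongr; exact (hab n).le
  rw [div_lt_iff₀ hε] at hn
  linarith

theorem continuous_of_forall_nhds_zero {𝕜 E G : Type*} [RCLike 𝕜] [AddCommGroup E] [Module 𝕜 E]
    [TopologicalSpace E] [IsTopologicalAddGroup E] [AddCommGroup G] [Module 𝕜 G]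
    [TopologicalSpace G] [IsTopologicalAddGroup G] (l : E →ₗ[𝕜] G)
    (h : ∀ W ∈ 𝓝 (0 : G), ∀ᶠ x in 𝓝 0, l x ∈ W) : Continuous l :=
  continuous_of_continuousAt_zero l (by
    rw [ContinuousAt, map_zero]
    exact h)

/-! ### Action of `A` on dual spaces -/

section Action

variable {𝕜 : Type*} [RCLike 𝕜]
  {A : Type*} [AddCommGroup A] [Module 𝕜 A] [TopologicalSpace A]
  {M₁ : Type*} [AddCommGroup M₁] [Module 𝕜 M₁] [Module ℝ M₁] [IsScalarTower ℝ 𝕜 M₁]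
  [TopologicalSpace M₁]
  {M₂ : Type*} [AddCommGroup M₂] [Module 𝕜 M₂] [Module ℝ M₂] [IsScalarTower ℝ 𝕜 M₂]

section

variable [TopologicalSpace M₂] {f : A →ₗ[𝕜] M₁ →ₗ[𝕜] M₂}

/-- The bilinear map `(a, φ) ↦ φ ∘ f(a, ·)`. -/
def IsSeparatelyContinuous.dualAction (hf : IsSeparatelyContinuous f) :
    A →ₗ[𝕜] DualC 𝕜 M₂ →ₗ[𝕜] DualC 𝕜 M₁ :=
  LinearMap.mk₂ 𝕜 (fun a φ => transpose (hf.partialMap a) φ)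
    (fun a a' φ => DualC.ext fun x =>
      (congrArg φ (show f (a + a') x = f a x + f a' x by rw [map_add]; rfl)).trans (map_add φ _ _))
    (fun c a φ => DualC.ext fun x =>
      (congrArg φ (show f (c • a) x = c • f a x by rw [map_smul]; rfl)).trans (map_smul φ _ _))
    (fun a φ ψ => map_add _ φ ψ) (fun c a φ => map_smul _ c φ)

theorem IsHypocontinuous.image2_dualAction_mem [IsTopologicalAddGroup M₁]
    [IsTopologicalAddGroup M₂] (hf : IsHypocontinuous f) {K : Set A}
    (hK : Bornology.IsVonNBounded 𝕜 K) {X : Set (DualC 𝕜 M₂)} (hX : X ∈ equicontinuousSets 𝕜 M₂) :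
    Set.image2 (fun a φ => hf.toIsSeparatelyContinuous.dualAction a φ) K X ∈
      equicontinuousSets 𝕜 M₁ := by
  refine mem_equicontinuousSets_iff.2 fun ε hε => ?_
  obtain ⟨V, hV, h⟩ := hf.hypo_left K hK _ (mem_equicontinuousSets_iff.1 hX ε hε)
  filter_upwards [hV] with x hx
  rintro _ ⟨a, ha, φ, hφ, rfl⟩
  exact h a ha x hx φ hφ

end

/-- Smallness of `φ ∘ f(a, ·)` on `C`, uniformly in `a ∈ K`, is smallness of `φ` on the compact set
`f(K × C)`, and that set lies in an absolutely convex compact one. -/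
theorem IsHypocontinuous.eventually_dualAction_mem [IsTopologicalAddGroup A] [ContinuousSMul 𝕜 A]
    [IsTopologicalAddGroup M₁] [UniformSpace M₂] [IsUniformAddGroup M₂] [ContinuousSMul 𝕜 M₂]
    [LocallyConvexSpace ℝ M₂] [CompleteSpace M₂] {f : A →ₗ[𝕜] M₁ →ₗ[𝕜] M₂}
    (hf : IsHypocontinuous f) {K : Set A} (hK : IsCompact K) {V : Set (DualC 𝕜 M₁)}
    (hV : V ∈ 𝓝 0) :
    ∀ᶠ φ in 𝓝 (0 : DualC 𝕜 M₂), ∀ a ∈ K, hf.toIsSeparatelyContinuous.dualAction a φ ∈ V := by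
  -- Convergence along the product with the principal filter of `K` is convergence uniform in `a ∈
  -- K`.
  have h : Filter.Tendsto
      (fun p : DualC 𝕜 M₂ × A => hf.toIsSeparatelyContinuous.dualAction p.2 p.1)
      (𝓝 0 ×ˢ Filter.principal K) (𝓝 0) := by
    refine DualC.tendsto_zero_iff.2 fun C hC ε hε => ?_
    obtain ⟨D, hD, hCD⟩ := exists_absConvexCompacts_superset (𝕜 := 𝕜) (hf.isCompact_image2 hK hC.2.2)
    rw [Filter.eventually_prod_principal_iff]
    filter_upwards [DualC.tendsto_zero_iff.1 Filter.tendsto_id D hD ε hε] with φ hφ a ha x hx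
    exact hφ _ (hCD ⟨a, ha, x, hx, rfl⟩)
  exact Filter.eventually_prod_principal_iff.1 (h hV)

end Action

/-! ### Construction and hypocontinuity of `σ` -/

section TensorAction

variable {𝕜 : Type*} [RCLike 𝕜]
  {A : Type*} [AddCommGroup A] [Module 𝕜 A] [TopologicalSpace A] [IsTopologicalAddGroup A]
  [ContinuousSMul 𝕜 A]
  {B : Type*} [AddCommGroup B] [Module 𝕜 B] [TopologicalSpace B] [IsTopologicalAddGroup B]
  [ContinuousSMul 𝕜 B]
  {M₁ : Type*} [AddCommGroup M₁] [Module 𝕜 M₁] [Module ℝ M₁] [IsScalarTower ℝ 𝕜 M₁]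
  [TopologicalSpace M₁] [IsTopologicalAddGroup M₁]
  {N₁ : Type*} [AddCommGroup N₁] [Module 𝕜 N₁] [Module ℝ N₁] [IsScalarTower ℝ 𝕜 N₁]
  [TopologicalSpace N₁] [IsTopologicalAddGroup N₁] [ContinuousSMul 𝕜 N₁]
  {M₂ : Type*} [AddCommGroup M₂] [Module 𝕜 M₂] [Module ℝ M₂] [IsScalarTower ℝ 𝕜 M₂]
  [UniformSpace M₂] [IsUniformAddGroup M₂]
  {N₂ : Type*} [AddCommGroup N₂] [Module 𝕜 N₂] [Module ℝ N₂] [IsScalarTower ℝ 𝕜 N₂]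
  [UniformSpace N₂] [IsUniformAddGroup N₂]
  {f : A →ₗ[𝕜] M₁ →ₗ[𝕜] M₂} {g : B →ₗ[𝕜] N₁ →ₗ[𝕜] N₂}

open UniformSpace (Completion)

/-- The bilinear form `(a, b) ↦ u(φ ∘ f(a, ·), ψ ∘ g(b, ·))`. -/
def pairing (hf : IsHypocontinuous f) (hg : IsHypocontinuous g) (u : EpsProduct 𝕜 M₁ N₁)
    (φ : DualC 𝕜 M₂) (ψ : DualC 𝕜 N₂) : A →ₗ[𝕜] B →ₗ[𝕜] 𝕜 :=
  u.form.compl₁₂ (hf.toIsSeparatelyContinuous.dualAction.flip φ)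
    (hg.toIsSeparatelyContinuous.dualAction.flip ψ)

/-- A set of elements of the ε-product is uniformly bounded on products of equicontinuous sets. -/
def IsUniformlyBounded (T : Set (EpsProduct 𝕜 M₁ N₁)) : Prop :=
  ∀ X ∈ equicontinuousSets 𝕜 M₁, ∀ Y ∈ equicontinuousSets 𝕜 N₁,
    ∃ C, ∀ u ∈ T, ∀ φ ∈ X, ∀ ψ ∈ Y, ‖u.form φ ψ‖ ≤ C

-- For `a` and `b` in bounded sets, the functionals `φ ∘ f(a, ·)` and `ψ ∘ g(b, ·)` run through
-- equicontinuous sets, on whose product `T` is uniformly bounded. Metrizability turns this into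
-- equicontinuity.
omit [ContinuousSMul 𝕜 N₁] in
theorem exists_nhds_pairing_le [FirstCountableTopology A] [FirstCountableTopology B]
    (hf : IsHypocontinuous f) (hg : IsHypocontinuous g) {T : Set (EpsProduct 𝕜 M₁ N₁)}
    (hT : IsUniformlyBounded T) {X : Set (DualC 𝕜 M₂)} (hX : X ∈ equicontinuousSets 𝕜 M₂)
    {Y : Set (DualC 𝕜 N₂)} (hY : Y ∈ equicontinuousSets 𝕜 N₂) {ε : ℝ} (hε : 0 < ε) :
    ∃ U ∈ 𝓝 (0 : A), ∃ V ∈ 𝓝 (0 : B), ∀ u ∈ T, ∀ φ ∈ X, ∀ ψ ∈ Y, ∀ a ∈ U, ∀ b ∈ V,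
      ‖pairing hf hg u φ ψ a b‖ ≤ ε := by
  obtain ⟨U, hU, V, hV, h⟩ := exists_nhds_norm_le_of_bounded
    (Φ := fun i : T × X × Y => pairing hf hg i.1.1 i.2.1.1 i.2.2.1) (fun K hK L hL => by
      obtain ⟨C, hC⟩ := hT _ (hf.image2_dualAction_mem hK hX) _ (hg.image2_dualAction_mem hL hY)
      exact ⟨C, fun i a ha b hb => hC _ i.1.2 _ ⟨a, ha, _, i.2.1.2, rfl⟩ _
        ⟨b, hb, _, i.2.2.2, rfl⟩⟩) hε
  exact ⟨U, hU, V, hV, fun u hu φ hφ ψ hψ => h (⟨u, hu⟩, ⟨φ, hφ⟩, ⟨ψ, hψ⟩)⟩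

/-- The linear form on `A ⊗ B` of a bilinear form. -/
def ProjTensor.lift {𝕜 A B : Type*} [RCLike 𝕜] [AddCommGroup A] [Module 𝕜 A] [AddCommGroup B]
    [Module 𝕜 B] (Φ : A →ₗ[𝕜] B →ₗ[𝕜] 𝕜) : ProjTensor 𝕜 A B →ₗ[𝕜] 𝕜 := TensorProduct.lift Φ

theorem ProjTensor.lift_tmul {𝕜 A B : Type*} [RCLike 𝕜] [AddCommGroup A] [Module 𝕜 A]
    [AddCommGroup B] [Module 𝕜 B] (Φ : A →ₗ[𝕜] B →ₗ[𝕜] 𝕜) (a : A) (b : B) :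
    lift Φ (tmul 𝕜 a b) = Φ a b := TensorProduct.lift.tmul a b

theorem TensorHull.norm_lift_le {𝕜 A B : Type*} [RCLike 𝕜] [AddCommGroup A] [Module 𝕜 A]
    [AddCommGroup B] [Module 𝕜 B] {Φ : A →ₗ[𝕜] B →ₗ[𝕜] 𝕜} {U : Set A} {V : Set B} {C : ℝ}
    (hC : 0 ≤ C) (h : ∀ a ∈ U, ∀ b ∈ V, ‖Φ a b‖ ≤ C) {z : ProjTensor 𝕜 A B}
    (hz : TensorHull U V 1 z) : ‖ProjTensor.lift Φ z‖ ≤ C := by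
  have := hz.seminorm_le ((normSeminorm 𝕜 𝕜).comp (ProjTensor.lift Φ)) hC fun a ha b hb => by
    rw [Seminorm.comp_apply, ProjTensor.lift_tmul]
    exact h a ha b hb
  simpa using this

variable [FirstCountableTopology A] [FirstCountableTopology B]

/-- The linear form `∑ aᵢ ⊗ bᵢ ↦ ∑ u(φ ∘ f(aᵢ, ·), ψ ∘ g(bᵢ, ·))` on `A ⊗ B`. -/
def tensorPairing (hf : IsHypocontinuous f) (hg : IsHypocontinuous g) (u : EpsProduct 𝕜 M₁ N₁)
    (φ : DualC 𝕜 M₂) (ψ : DualC 𝕜 N₂) : ProjTensor 𝕜 A B →L[𝕜] 𝕜 where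
  __ := ProjTensor.lift (pairing hf hg u φ ψ)
  cont := continuous_of_forall_nhds_zero _ fun W hW => by
    obtain ⟨ε, hε, hεW⟩ := Metric.nhds_basis_closedBall.mem_iff.1 hW
    obtain ⟨U, hU, V, hV, h⟩ := exists_nhds_pairing_le hf hg (T := {u})
      (fun X hX Y hY => by simpa using u.exists_bound hX hY)
      (singleton_mem_equicontinuousSets φ) (singleton_mem_equicontinuousSets ψ) hε
    filter_upwards [ProjTensor.tensorHull_mem_nhds hU hV one_pos] with z hz
    exact hεW (mem_closedBall_zero_iff.2
      (TensorHull.norm_lift_le hε.le (h u rfl φ rfl ψ rfl) hz))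

/-- The continuous extension of `tensorPairing` to the completion. -/
def completedPairing (hf : IsHypocontinuous f) (hg : IsHypocontinuous g) (u : EpsProduct 𝕜 M₁ N₁)
    (φ : DualC 𝕜 M₂) (ψ : DualC 𝕜 N₂) : CompletedTensor 𝕜 A B →L[𝕜] 𝕜 :=
  (tensorPairing hf hg u φ ψ).fromCompletion

theorem completedPairing_coe (hf : IsHypocontinuous f) (hg : IsHypocontinuous g)
    (u : EpsProduct 𝕜 M₁ N₁) (φ : DualC 𝕜 M₂) (ψ : DualC 𝕜 N₂) (z : ProjTensor 𝕜 A B) :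
    completedPairing hf hg u φ ψ z = ProjTensor.lift (pairing hf hg u φ ψ) z :=
  (tensorPairing hf hg u φ ψ).fromCompletion_apply_coe z

omit [FirstCountableTopology A] [FirstCountableTopology B] [IsTopologicalAddGroup A]
  [ContinuousSMul 𝕜 A] [IsTopologicalAddGroup B] [ContinuousSMul 𝕜 B] in
theorem CompletedTensor.continuousLinearMap_ext {l l' : CompletedTensor 𝕜 A B →L[𝕜] 𝕜}
    (h : ∀ a b, l (tmul 𝕜 a b) = l' (tmul 𝕜 a b)) : l = l' := by
  refine ContinuousLinearMap.coe_injective (LinearMap.ext fun z => ?_)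
  refine Completion.induction_on z (isClosed_eq l.continuous l'.continuous) fun z => ?_
  induction z using ProjTensor.induction with
  | zero => rw [Completion.coe_zero, map_zero, map_zero]
  | tmul a b => exact h a b
  | add x y hx hy =>
    simp only [ContinuousLinearMap.coe_coe] at hx hy ⊢
    rw [Completion.coe_add, map_add, map_add, hx, hy]

theorem completedPairing_tmul (hf : IsHypocontinuous f) (hg : IsHypocontinuous g)
    (u : EpsProduct 𝕜 M₁ N₁) (φ : DualC 𝕜 M₂) (ψ : DualC 𝕜 N₂) (a : A) (b : B) :
    completedPairing hf hg u φ ψ (CompletedTensor.tmul 𝕜 a b) =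
      u.form (hf.toIsSeparatelyContinuous.dualAction a φ)
        (hg.toIsSeparatelyContinuous.dualAction b ψ) :=
  (completedPairing_coe hf hg u φ ψ _).trans (ProjTensor.lift_tmul _ a b)

/-- The central estimate: a bound on `U × V` survives absolutely convex sums and limits. It is
applied to neighbourhoods for continuity in `z`, and to compact sets for continuity in `u`, `φ` and
`ψ`. -/
theorem norm_completedPairing_le (hf : IsHypocontinuous f) (hg : IsHypocontinuous g)
    {u : EpsProduct 𝕜 M₁ N₁} {φ : DualC 𝕜 M₂} {ψ : DualC 𝕜 N₂} {U : Set A} {V : Set B} {C : ℝ}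
    (hC : 0 ≤ C) (h : ∀ a ∈ U, ∀ b ∈ V, ‖pairing hf hg u φ ψ a b‖ ≤ C)
    {z : CompletedTensor 𝕜 A B}
    (hz : z ∈ closure ((↑) '' {z : ProjTensor 𝕜 A B | TensorHull U V 1 z})) :
    ‖completedPairing hf hg u φ ψ z‖ ≤ C := by
  have hcl : IsClosed {z | ‖completedPairing hf hg u φ ψ z‖ ≤ C} :=
    isClosed_le (completedPairing hf hg u φ ψ).continuous.norm continuous_const
  refine closure_minimal ?_ hcl hz
  rintro _ ⟨z, hz, rfl⟩
  rw [Set.mem_ofPred_eq, completedPairing_coe]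
  exact TensorHull.norm_lift_le hC h hz

variable [ContinuousSMul 𝕜 M₂] [LocallyConvexSpace ℝ M₂] [CompleteSpace M₂]
  [ContinuousSMul 𝕜 N₂] [LocallyConvexSpace ℝ N₂] [CompleteSpace N₂]

/-- The bilinear form `σ(z, u)` on `M₂'_c × N₂'_c`. -/
def actionForm (hf : IsHypocontinuous f) (hg : IsHypocontinuous g) (z : CompletedTensor 𝕜 A B)
    (u : EpsProduct 𝕜 M₁ N₁) : DualC 𝕜 M₂ →ₗ[𝕜] DualC 𝕜 N₂ →ₗ[𝕜] 𝕜 :=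
  LinearMap.mk₂ 𝕜 (fun φ ψ => completedPairing hf hg u φ ψ z)
    (fun φ φ' ψ => DFunLike.congr_fun (show completedPairing hf hg u (φ + φ') ψ =
      completedPairing hf hg u φ ψ + completedPairing hf hg u φ' ψ from
        CompletedTensor.continuousLinearMap_ext fun a b => by
          simp [completedPairing_tmul]) z)
    (fun c φ ψ => DFunLike.congr_fun (show completedPairing hf hg u (c • φ) ψ =
      c • completedPairing hf hg u φ ψ from
        CompletedTensor.continuousLinearMap_ext fun a b => by
          simp [completedPairing_tmul]) z)
    (fun φ ψ ψ' => DFunLike.congr_fun (show completedPairing hf hg u φ (ψ + ψ') =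
      completedPairing hf hg u φ ψ + completedPairing hf hg u φ ψ' from
        CompletedTensor.continuousLinearMap_ext fun a b => by
          simp [completedPairing_tmul]) z)
    (fun c φ ψ => DFunLike.congr_fun (show completedPairing hf hg u φ (c • ψ) =
      c • completedPairing hf hg u φ ψ from
        CompletedTensor.continuousLinearMap_ext fun a b => by
          simp [completedPairing_tmul]) z)

omit [IsTopologicalAddGroup A] [ContinuousSMul 𝕜 A] [IsTopologicalAddGroup B] [ContinuousSMul 𝕜 B]
  [FirstCountableTopology A] [FirstCountableTopology B] in
theorem CompletedTensor.exists_finite_cover_singleton (z : CompletedTensor 𝕜 A B)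
    {W : Set (CompletedTensor 𝕜 A B)} (hW : W ∈ 𝓝 0) :
    ∃ F : Set (ProjTensor 𝕜 A B), F.Finite ∧
      ∀ s ∈ ({z} : Set (CompletedTensor 𝕜 A B)), ∃ t ∈ F, s - (t : CompletedTensor 𝕜 A B) ∈ W := by
  obtain ⟨t, -, ht⟩ := exists_sub_mem_of_mem_closure (T := Set.univ) (s := z)
    (by rw [Set.image_univ]; exact Completion.denseRange_coe z) hW
  exact ⟨{t}, Set.finite_singleton t, by simpa using ht⟩

/-- A single `z` lies in the closed hull of `K ⊗ L` with `K`, `L` compact, so it suffices to bound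
`u(φ ∘ f(a, ·), ψ ∘ g(b, ·))` for `a ∈ K`, `b ∈ L`. One family of functionals stays equicontinuous
while the other becomes uniformly small, and `u` is hypocontinuous. -/
theorem isHypocontinuousOn_actionForm (hf : IsHypocontinuous f) (hg : IsHypocontinuous g)
    (z : CompletedTensor 𝕜 A B) (u : EpsProduct 𝕜 M₁ N₁) :
    IsHypocontinuousOn (equicontinuousSets 𝕜 M₂) (equicontinuousSets 𝕜 N₂)
      (actionForm hf hg z u) := by
  obtain ⟨K, L, hK, hL, hz⟩ := CompletedTensor.exists_isCompact_subset_closure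
    fun W hW => z.exists_finite_cover_singleton hW
  have h_left : ∀ X ∈ equicontinuousSets 𝕜 M₂, ∀ W ∈ 𝓝 (0 : 𝕜), ∃ V ∈ 𝓝 (0 : DualC 𝕜 N₂),
      ∀ φ ∈ X, ∀ ψ ∈ V, actionForm hf hg z u φ ψ ∈ W := by
    intro X hX W hW
    obtain ⟨ε, hε, hεW⟩ := Metric.nhds_basis_closedBall.mem_iff.1 hW
    obtain ⟨V, hV, h⟩ := u.2.hypo_left _ (hf.image2_dualAction_mem (hK.isVonNBounded 𝕜) hX) _
      (Metric.closedBall_mem_nhds 0 hε)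
    refine ⟨_, hg.eventually_dualAction_mem hL hV, fun φ hφ ψ hψ => hεW ?_⟩
    exact mem_closedBall_zero_iff.2 (norm_completedPairing_le hf hg hε.le (fun a ha b hb =>
      mem_closedBall_zero_iff.1 (h _ ⟨a, ha, φ, hφ, rfl⟩ _ (hψ b hb))) (hz rfl))
  have h_right : ∀ Y ∈ equicontinuousSets 𝕜 N₂, ∀ W ∈ 𝓝 (0 : 𝕜), ∃ V ∈ 𝓝 (0 : DualC 𝕜 M₂),
      ∀ φ ∈ V, ∀ ψ ∈ Y, actionForm hf hg z u φ ψ ∈ W := by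
    intro Y hY W hW
    obtain ⟨ε, hε, hεW⟩ := Metric.nhds_basis_closedBall.mem_iff.1 hW
    obtain ⟨V, hV, h⟩ := u.2.hypo_right _ (hg.image2_dualAction_mem (hL.isVonNBounded 𝕜) hY) _
      (Metric.closedBall_mem_nhds 0 hε)
    refine ⟨_, hf.eventually_dualAction_mem hK hV, fun φ hφ ψ hψ => hεW ?_⟩
    exact mem_closedBall_zero_iff.2 (norm_completedPairing_le hf hg hε.le (fun a ha b hb =>
      mem_closedBall_zero_iff.1 (h _ (hφ a ha) _ ⟨b, hb, ψ, hψ, rfl⟩)) (hz rfl))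
  refine ⟨⟨fun φ => ?_, fun ψ => ?_⟩, h_left, h_right⟩
  · refine continuous_of_forall_nhds_zero (actionForm hf hg z u φ) fun W hW => ?_
    obtain ⟨V, hV, h⟩ := h_left _ (singleton_mem_equicontinuousSets φ) W hW
    exact Filter.mem_of_superset hV (h φ rfl)
  · refine continuous_of_forall_nhds_zero ((actionForm hf hg z u).flip ψ) fun W hW => ?_
    obtain ⟨V, hV, h⟩ := h_right _ (singleton_mem_equicontinuousSets ψ) W hW
    exact Filter.mem_of_superset hV fun φ hφ => h φ hφ ψ rfl

/-- The bilinear map `σ : (A ⊗̂ B) × (M₁ ε N₁) → M₂ ε N₂`. -/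
def tensorAction (hf : IsHypocontinuous f) (hg : IsHypocontinuous g) :
    CompletedTensor 𝕜 A B →ₗ[𝕜] EpsProduct 𝕜 M₁ N₁ →ₗ[𝕜] EpsProduct 𝕜 M₂ N₂ :=
  LinearMap.mk₂ 𝕜 (fun z u => ⟨actionForm hf hg z u, isHypocontinuousOn_actionForm hf hg z u⟩)
    (fun z z' u => EpsProduct.ext fun φ ψ => map_add (completedPairing hf hg u φ ψ) z z')
    (fun c z u => EpsProduct.ext fun φ ψ => map_smul (completedPairing hf hg u φ ψ) c z)
    (fun z u v => EpsProduct.ext fun φ ψ => DFunLike.congr_fun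
      (show completedPairing hf hg (u + v) φ ψ =
        completedPairing hf hg u φ ψ + completedPairing hf hg v φ ψ from
          CompletedTensor.continuousLinearMap_ext fun a b => by
            simp [completedPairing_tmul, EpsProduct.form_add]) z)
    (fun c z u => EpsProduct.ext fun φ ψ => DFunLike.congr_fun
      (show completedPairing hf hg (c • u) φ ψ = c • completedPairing hf hg u φ ψ from
          CompletedTensor.continuousLinearMap_ext fun a b => by
            simp [completedPairing_tmul, EpsProduct.form_smul]) z)

theorem tensorAction_tmul (hf : IsHypocontinuous f) (hg : IsHypocontinuous g) (a : A) (b : B)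
    (u : EpsProduct 𝕜 M₁ N₁) :
    tensorAction hf hg (.tmul 𝕜 a b) u = epsMap (hf.toIsSeparatelyContinuous.partialMap a)
      (hg.toIsSeparatelyContinuous.partialMap b) u :=
  EpsProduct.ext fun φ ψ => completedPairing_tmul hf hg u φ ψ a b

/-- On `S` the values of `σ` are governed by those of `u` on one product of equicontinuous sets,
namely the orbits of `X` and `Y` under `K` and `L`. Smallness there is a neighbourhood condition on
`u`. -/
theorem eventually_tensorAction_mem_of_totallyBounded (hf : IsHypocontinuous f)
    (hg : IsHypocontinuous g) {S : Set (CompletedTensor 𝕜 A B)}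
    (hS : ∀ W ∈ 𝓝 (0 : CompletedTensor 𝕜 A B), ∃ F : Set (ProjTensor 𝕜 A B), F.Finite ∧
      ∀ s ∈ S, ∃ t ∈ F, s - (t : CompletedTensor 𝕜 A B) ∈ W)
    {W : Set (EpsProduct 𝕜 M₂ N₂)} (hW : W ∈ 𝓝 0) :
    ∀ᶠ u in 𝓝 (0 : EpsProduct 𝕜 M₁ N₁), ∀ z ∈ S, tensorAction hf hg z u ∈ W := by
  obtain ⟨K, L, hK, hL, hKL⟩ := CompletedTensor.exists_isCompact_subset_closure hS
  have h : Filter.Tendsto (fun p : EpsProduct 𝕜 M₁ N₁ × CompletedTensor 𝕜 A B =>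
      tensorAction hf hg p.2 p.1) (𝓝 0 ×ˢ Filter.principal S) (𝓝 0) := by
    refine EpsProduct.tendsto_zero_iff.2 fun X hX Y hY ε hε => ?_
    rw [Filter.eventually_prod_principal_iff]
    filter_upwards [EpsProduct.eventually_nhds_zero
      (hf.image2_dualAction_mem (hK.isVonNBounded 𝕜) hX)
      (hg.image2_dualAction_mem (hL.isVonNBounded 𝕜) hY) (half_pos hε)] with u hu z hz φ hφ ψ hψ
    refine lt_of_le_of_lt (norm_completedPairing_le hf hg (half_pos hε).le (fun a ha b hb => ?_)
      (hKL hz)) (half_lt_self hε)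
    exact (hu _ ⟨a, ha, φ, hφ, rfl⟩ _ ⟨b, hb, ψ, hψ, rfl⟩).le
  exact Filter.eventually_prod_principal_iff.1 (h hW)

theorem eventually_tensorAction_mem_of_isUniformlyBounded (hf : IsHypocontinuous f)
    (hg : IsHypocontinuous g) {T : Set (EpsProduct 𝕜 M₁ N₁)} (hT : IsUniformlyBounded T)
    {W : Set (EpsProduct 𝕜 M₂ N₂)} (hW : W ∈ 𝓝 0) :
    ∀ᶠ z in 𝓝 (0 : CompletedTensor 𝕜 A B), ∀ u ∈ T, tensorAction hf hg z u ∈ W := by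
  have h : Filter.Tendsto (fun p : CompletedTensor 𝕜 A B × EpsProduct 𝕜 M₁ N₁ =>
      tensorAction hf hg p.1 p.2) (𝓝 0 ×ˢ Filter.principal T) (𝓝 0) := by
    refine EpsProduct.tendsto_zero_iff.2 fun X hX Y hY ε hε => ?_
    rw [Filter.eventually_prod_principal_iff]
    obtain ⟨U, hU, V, hV, h⟩ := exists_nhds_pairing_le hf hg hT hX hY (half_pos hε)
    filter_upwards [CompletedTensor.closure_tensorHull_mem_nhds hU hV one_pos]
      with z hz u hu φ hφ ψ hψ
    exact lt_of_le_of_lt (norm_completedPairing_le hf hg (half_pos hε).le (h u hu φ hφ ψ hψ) hz)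
      (half_lt_self hε)
  exact Filter.eventually_prod_principal_iff.1 (h hW)

theorem isSeparatelyContinuous_tensorAction (hf : IsHypocontinuous f) (hg : IsHypocontinuous g) :
    IsSeparatelyContinuous (tensorAction hf hg) where
  continuous_right z := continuous_of_forall_nhds_zero (tensorAction hf hg z) fun _ hW =>
    (eventually_tensorAction_mem_of_totallyBounded hf hg
      (fun _ hO => z.exists_finite_cover_singleton hO) hW).mono fun _ h => h z rfl
  continuous_left u := continuous_of_forall_nhds_zero ((tensorAction hf hg).flip u) fun _ hW =>
    (eventually_tensorAction_mem_of_isUniformlyBounded hf hg (T := {u})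
      (fun X hX Y hY => by simpa using u.exists_bound hX hY) hW).mono fun _ h => h u rfl

/-- Nuclearity serves only to make bounded sets of tensors totally bounded. -/
theorem isHypocontinuous_tensorAction [Module ℝ A] [IsScalarTower ℝ 𝕜 A] [LocallyConvexSpace ℝ A]
    [Module ℝ B] [IsScalarTower ℝ 𝕜 B] [LocallyConvexSpace ℝ B] (hA : IsNuclearSpace 𝕜 A)
    (hB : IsNuclearSpace 𝕜 B) (hf : IsHypocontinuous f) (hg : IsHypocontinuous g) :
    IsHypocontinuous (tensorAction hf hg) where
  toIsSeparatelyContinuous := isSeparatelyContinuous_tensorAction hf hg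
  hypo_left _ hS _ hW := ⟨_, eventually_tensorAction_mem_of_totallyBounded hf hg
    (fun _ hO => CompletedTensor.exists_finite_cover hA hB hS hO) hW, fun z hz _ hu => hu z hz⟩
  hypo_right _ hT _ hW := ⟨_, eventually_tensorAction_mem_of_isUniformlyBounded hf hg
    (fun _ hX _ hY => EpsProduct.exists_bound_of_isVonNBounded hT hX hY) hW,
    fun _ hz u hu => hz u hu⟩

end TensorAction

/-! ### Uniqueness of `σ` -/

section Uniqueness

variable {𝕜 : Type*} [RCLike 𝕜]
  {A : Type*} [AddCommGroup A] [Module 𝕜 A] [TopologicalSpace A]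
  {B : Type*} [AddCommGroup B] [Module 𝕜 B] [TopologicalSpace B]
  {M₁ : Type*} [AddCommGroup M₁] [Module 𝕜 M₁] [Module ℝ M₁] [TopologicalSpace M₁]
  {N₁ : Type*} [AddCommGroup N₁] [Module 𝕜 N₁] [Module ℝ N₁] [TopologicalSpace N₁]
  {M₂ : Type*} [AddCommGroup M₂] [Module 𝕜 M₂] [Module ℝ M₂] [TopologicalSpace M₂]
  [IsTopologicalAddGroup M₂]
  {N₂ : Type*} [AddCommGroup N₂] [Module 𝕜 N₂] [Module ℝ N₂] [TopologicalSpace N₂]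
  [IsTopologicalAddGroup N₂]

/-- Evaluation at `(φ, ψ)` is continuous on `M₂ ε N₂`, so for fixed `u` both maps yield continuous
linear forms in `z`, and these are determined by the elementary tensors. -/
theorem IsSeparatelyContinuous.eq_of_tmul {σ τ : CompletedTensor 𝕜 A B →ₗ[𝕜]
      EpsProduct 𝕜 M₁ N₁ →ₗ[𝕜] EpsProduct 𝕜 M₂ N₂}
    (hσ : IsSeparatelyContinuous σ) (hτ : IsSeparatelyContinuous τ)
    (h : ∀ a b u, σ (.tmul 𝕜 a b) u = τ (.tmul 𝕜 a b) u) : σ = τ := by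
  refine LinearMap.ext fun z => LinearMap.ext fun u => EpsProduct.ext fun φ ψ => ?_
  let ev (ρ : CompletedTensor 𝕜 A B →ₗ[𝕜] EpsProduct 𝕜 M₁ N₁ →ₗ[𝕜] EpsProduct 𝕜 M₂ N₂)
      (hρ : IsSeparatelyContinuous ρ) : CompletedTensor 𝕜 A B →L[𝕜] 𝕜 :=
    { toFun := fun z => (ρ z u).form φ ψ
      map_add' := fun z z' => by rw [map_add]; rfl
      map_smul' := fun c z => by rw [map_smul]; rfl
      cont := (EpsProduct.continuous_form_apply φ ψ).comp (hρ.continuous_left u) }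
  exact DFunLike.congr_fun (CompletedTensor.continuousLinearMap_ext (l := ev σ hσ) (l' := ev τ hτ)
    fun a b => congrArg (fun v : EpsProduct 𝕜 M₂ N₂ => v.form φ ψ) (h a b u)) z

end Uniqueness

end LCS

end

theorem mainTheorem4 {𝕜 : Type*} [RCLike 𝕜]
    -- `A`, `B`: Fréchet spaces
    {A : Type*} [AddCommGroup A] [Module 𝕜 A] [Module ℝ A] [IsScalarTower ℝ 𝕜 A]
    [UniformSpace A] [IsUniformAddGroup A] [ContinuousSMul 𝕜 A] [LocallyConvexSpace ℝ A]
    [T2Space A] [CompleteSpace A] [FirstCountableTopology A]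
    {B : Type*} [AddCommGroup B] [Module 𝕜 B] [Module ℝ B] [IsScalarTower ℝ 𝕜 B]
    [UniformSpace B] [IsUniformAddGroup B] [ContinuousSMul 𝕜 B] [LocallyConvexSpace ℝ B]
    [T2Space B] [CompleteSpace B] [FirstCountableTopology B]
    -- `M₁`, `N₁`: Hausdorff locally convex spaces
    {M₁ : Type*} [AddCommGroup M₁] [Module 𝕜 M₁] [Module ℝ M₁] [IsScalarTower ℝ 𝕜 M₁]
    [TopologicalSpace M₁] [IsTopologicalAddGroup M₁] [ContinuousSMul 𝕜 M₁]
    [LocallyConvexSpace ℝ M₁] [T2Space M₁]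
    {N₁ : Type*} [AddCommGroup N₁] [Module 𝕜 N₁] [Module ℝ N₁] [IsScalarTower ℝ 𝕜 N₁]
    [TopologicalSpace N₁] [IsTopologicalAddGroup N₁] [ContinuousSMul 𝕜 N₁]
    [LocallyConvexSpace ℝ N₁] [T2Space N₁]
    -- `M₂`, `N₂`: complete Hausdorff locally convex spaces
    {M₂ : Type*} [AddCommGroup M₂] [Module 𝕜 M₂] [Module ℝ M₂] [IsScalarTower ℝ 𝕜 M₂]
    [UniformSpace M₂] [IsUniformAddGroup M₂] [ContinuousSMul 𝕜 M₂] [LocallyConvexSpace ℝ M₂]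
    [T2Space M₂] [CompleteSpace M₂]
    {N₂ : Type*} [AddCommGroup N₂] [Module 𝕜 N₂] [Module ℝ N₂] [IsScalarTower ℝ 𝕜 N₂]
    [UniformSpace N₂] [IsUniformAddGroup N₂] [ContinuousSMul 𝕜 N₂] [LocallyConvexSpace ℝ N₂]
    [T2Space N₂] [CompleteSpace N₂]
    (hA : LCS.IsNuclearSpace 𝕜 A) (hB : LCS.IsNuclearSpace 𝕜 B)
    (f : A →ₗ[𝕜] M₁ →ₗ[𝕜] M₂) (hf : LCS.IsHypocontinuous f)
    (g : B →ₗ[𝕜] N₁ →ₗ[𝕜] N₂) (hg : LCS.IsHypocontinuous g) :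
    ∃ σ : LCS.CompletedTensor 𝕜 A B →ₗ[𝕜] LCS.EpsProduct 𝕜 M₁ N₁ →ₗ[𝕜] LCS.EpsProduct 𝕜 M₂ N₂,
      (LCS.IsSeparatelyContinuous σ ∧
        ∀ (a : A) (b : B) (u : LCS.EpsProduct 𝕜 M₁ N₁),
          σ (LCS.CompletedTensor.tmul 𝕜 a b) u =
            LCS.epsMap (hf.toIsSeparatelyContinuous.partialMap a)
              (hg.toIsSeparatelyContinuous.partialMap b) u) ∧
      (∀ τ : LCS.CompletedTensor 𝕜 A B →ₗ[𝕜]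
          LCS.EpsProduct 𝕜 M₁ N₁ →ₗ[𝕜] LCS.EpsProduct 𝕜 M₂ N₂,
        LCS.IsSeparatelyContinuous τ →
        (∀ (a : A) (b : B) (u : LCS.EpsProduct 𝕜 M₁ N₁),
          τ (LCS.CompletedTensor.tmul 𝕜 a b) u =
            LCS.epsMap (hf.toIsSeparatelyContinuous.partialMap a)
              (hg.toIsSeparatelyContinuous.partialMap b) u) →
        τ = σ) ∧
      LCS.IsHypocontinuous σ := by
  exact ⟨LCS.tensorAction hf hg,
    ⟨LCS.isSeparatelyContinuous_tensorAction hf hg, LCS.tensorAction_tmul hf hg⟩,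
    fun _ hτ h => hτ.eq_of_tmul (LCS.isSeparatelyContinuous_tensorAction hf hg)
      fun a b u => (h a b u).trans (LCS.tensorAction_tmul hf hg a b u).symm,
    LCS.isHypocontinuous_tensorAction hA hB hf hg⟩
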